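/- For real $k\ge 1$ and $x>0$ let $$P_k(x):=\sum_{n=1}^{\infty}\frac{\mu(n)}{n^{k}}\,e^{-x/n^{2}},$$ where $\mu$ is the Möbius function; the series converges (as the limit of its partial sums $\sum_{n\le N}$; for $k=1$ not absolutely). Then, for every real $k\ge 1$, the Riemann hypothesis holds if and only if, for every $\varepsilon>0$, $$P_k(x)=O_{\varepsilon}\!\left(x^{-\frac{k}{2}+\frac14+\varepsilon}\right)\qquad\text{as } x\to\infty .$$ In particular, $k=1$ gives the Hardy–Littlewood criterion $P_1(x)=O_\varepsilon(x^{-1/4+\varepsilon})$ and $k=2$ gives the Riesz criterion $P_2(x)=O_\varepsilon(x^{-3/4+\varepsilon})$. -/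

import Mathlib

open Filter Asymptotics

open scoped ArithmeticFunction.Moebius

/-- The `n`-th term `μ(n) n^{-k} e^{-x/n²}` of the series below. The term at `n = 0` vanishes,
since `μ 0 = 0`, so a sum over `n ≥ 0` is a sum over `n ≥ 1`. -/
noncomputable def rieszTerm (k x : ℝ) (n : ℕ) : ℝ :=
  (μ n : ℝ) / (n : ℝ) ^ k * Real.exp (-x / (n : ℝ) ^ 2)

/-- `P_k(x) = ∑_{n ≥ 1} μ(n) n^{-k} e^{-x/n²}`, the limit of the partial sums in the usual order
of the summation index (for `k = 1` the series does not converge absolutely). -/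
noncomputable def rieszP (k x : ℝ) : ℝ :=
  ∑'[SummationFilter.conditional ℕ] n : ℕ, rieszTerm k x n

/-! Integrating termwise, the Mellin transform of `rieszP k` is `Γ(s) / ζ(k - 2s)` on `0 < Re s < (k
- 1)/2` (`mellin_rieszP`), so decay of `P_k` corresponds to absence of zeros of `ζ`. This strip is
empty for `k = 1`. Hence both directions work with `P_{k+2} = -P_k'` (`hasDerivAt_rieszP`), whose
transform at `s + 1` is `Γ(s + 1) / ζ(k - 2s)`, and pass between `P_{k+2}` and `P_k` by integration.

From the bound to RH: integrating by parts on `(1, ∞)` expresses this transform through `P_k` on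
`(1, ∞)` and `P_{k+2}` on `(0, 1]`. The assumed bound makes that expression holomorphic for `-1 < Re
s < k/2 - 1/4`. By the identity theorem a zero of `ζ` in `1/2 < Re w < 1` would force a zero of `Γ`;
the functional equation reflects the conclusion to the left half.

From RH to the bound: Mellin inversion gives `P_{k+2}` as an integral over `Re s = k/2`. The line
moves right until `Re(k + 2 - 2s) = 1/2 + δ`. This is allowed because `1/ζ` grows polynomially there
(`exists_norm_inv_riemannZeta₁_le`, by Borel–Carathéodory) while `Γ` decays faster than any power
(`exists_norm_Gamma_mul_pow_le`). Integrating from `x` to `∞` recovers `P_k`, since `P_k → 0`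
(`tendsto_rieszP_atTop`).

For `k = 1` both the convergence of the series and `P_k → 0` rest on the convergence of `∑ μ(n)/n`,
a statement of prime number theorem strength, obtained by Newman's contour method
(`tendsto_sum_term_one`). -/

/-! ### Newman's Tauberian theorem and the series `∑ μ(n)/n` -/

open Complex MeasureTheory Topology in
/-- Cauchy's theorem for the closed right half-disc, for a function that is merely continuous up to
the imaginary axis. -/
theorem integral_halfCircle_eq_integral_imaginary_segment {H : ℂ → ℂ} {R : ℝ} (hR : 0 < R)
    (hc : ContinuousOn H {z | 0 ≤ z.re}) (hd : DifferentiableOn ℂ H {z | 0 < z.re}) :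
    ∫ θ in (-(Real.pi / 2))..(Real.pi / 2), circleMap 0 R θ * H (circleMap 0 R θ) =
      ∫ t in (-R)..R, H (t * I) := by
  -- The retraction onto the closed right half-plane makes `H ∘ p` continuous everywhere, which
  -- removes boundary conditions from the limit `σ → 0⁺` below.
  set p : ℂ → ℂ := fun z => (max z.re 0 : ℝ) + z.im * I with hp
  have hpc : Continuous p := by fun_prop
  have hpre : ∀ z, 0 ≤ (p z).re := fun z => by simp [hp]
  have hpid : ∀ z : ℂ, 0 ≤ z.re → p z = z := fun z hz => by
    simp only [hp, max_eq_left hz]; exact re_add_im z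
  have hHp : Continuous (fun z => H (p z)) := hc.comp_continuous hpc hpre
  have hcos : ∀ θ ∈ Set.uIcc (-(Real.pi / 2)) (Real.pi / 2), 0 ≤ (circleMap 0 R θ).re := by
    intro θ hθ
    rw [Set.uIcc_of_le (by linarith [Real.pi_pos])] at hθ
    have := Real.cos_nonneg_of_mem_Icc hθ
    simp only [circleMap, zero_add, re_ofReal_mul, exp_ofReal_mul_I_re]
    positivity
  have key : ∀ σ : ℝ, 0 < σ →
      ∫ θ in (-(Real.pi / 2))..(Real.pi / 2),
        circleMap 0 R θ * H (p (σ + circleMap 0 R θ)) =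
      ∫ t in (-R)..R, H (p (σ + t * I)) := by
    intro σ hσ
    -- The half-disc shifted by `σ` fits in a ball tangent to the imaginary axis: `|z - L|² = |z|² -
    -- 2L Re z + L² < L²` once `L σ = (σ + R)²`. On that ball `H` has a primitive, so both paths
    -- give the same endpoint difference.
    set L : ℝ := (σ + R) ^ 2 / σ with hL
    have hLpos : 0 < L := by positivity
    have hball : ∀ z : ℂ, σ ≤ z.re → ‖z‖ ≤ σ + R → z ∈ Metric.ball (L : ℂ) L := by
      intro z hz1 hz2
      rw [Metric.mem_ball, dist_eq_norm, ← sq_lt_sq₀ (norm_nonneg _) hLpos.le, Complex.sq_norm,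
        normSq_apply]
      have h3 : z.re * z.re + z.im * z.im ≤ (σ + R) ^ 2 := by
        rw [← normSq_apply, ← Complex.sq_norm]; gcongr
      have h4 : L * σ = (σ + R) ^ 2 := by rw [hL]; field_simp
      have h5 : L * σ ≤ L * z.re := by gcongr
      have h6 : 0 < (σ + R) ^ 2 := by positivity
      simp only [sub_re, ofReal_re, sub_im, ofReal_im]
      nlinarith
    have hsub : Metric.ball (L : ℂ) L ⊆ {z | 0 < z.re} := by
      intro z hz
      rw [Metric.mem_ball, dist_eq_norm] at hz
      have h2 := (abs_re_le_norm (z - L)).trans_lt hz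
      rw [abs_lt] at h2
      simp at h2
      exact h2.1
    obtain ⟨G, hG⟩ := (hd.mono hsub).isExactOn_ball
    have e1 : ∫ θ in (-(Real.pi / 2))..(Real.pi / 2),
        circleMap 0 R θ * H (p (σ + circleMap 0 R θ)) =
        (-I) * G (σ + circleMap 0 R (Real.pi / 2)) - (-I) * G (σ + circleMap 0 R (-(Real.pi / 2))) := by
      apply intervalIntegral.integral_eq_sub_of_hasDerivAt
        (f := fun θ => (-I) * G (σ + circleMap 0 R θ))
      · intro θ hθ
        have h0 := hcos θ hθ
        have hre : σ ≤ (σ + circleMap 0 R θ).re := by simpa using h0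
        have hn : ‖(σ : ℂ) + circleMap 0 R θ‖ ≤ σ + R := by
          refine (norm_add_le _ _).trans ?_
          simp [abs_of_pos hσ, abs_of_pos hR]
        have h1 := hG _ (hball _ hre hn)
        rw [hpid _ (hσ.le.trans hre)]
        have h2 := (hasDerivAt_circleMap 0 R θ).const_add (σ : ℂ)
        have h3 := (h1.comp θ h2).const_mul (-I)
        refine h3.congr_deriv ?_
        linear_combination (-circleMap 0 R θ * H (σ + circleMap 0 R θ)) * I_sq
      · exact ((continuous_circleMap 0 R).mul
          (hHp.comp (continuous_const.add (continuous_circleMap 0 R)))).intervalIntegrable _ _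
    have e2 : ∫ t in (-R)..R, H (p (σ + t * I)) =
        (-I) * G (σ + (R : ℝ) * I) - (-I) * G (σ + ((-R : ℝ) : ℂ) * I) := by
      apply intervalIntegral.integral_eq_sub_of_hasDerivAt
        (f := fun t : ℝ => (-I) * G (σ + t * I))
      · intro t ht
        rw [Set.uIcc_of_le (by linarith)] at ht
        have hre : σ ≤ ((σ : ℂ) + t * I).re := by simp
        have hn : ‖(σ : ℂ) + t * I‖ ≤ σ + R := by
          refine (norm_add_le _ _).trans ?_
          simpa [abs_of_pos hσ] using abs_le.mpr ht
        have h1 := hG _ (hball _ hre hn)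
        rw [hpid _ (hσ.le.trans hre)]
        have h2 : HasDerivAt (fun t : ℝ => (σ : ℂ) + t * I) (1 * I) t :=
          ((ofRealCLM.hasDerivAt (x := t)).mul_const I).const_add (σ : ℂ)
        have h3 := (h1.comp t h2).const_mul (-I)
        refine h3.congr_deriv ?_
        rw [one_mul, mul_left_comm, neg_mul, I_mul_I]
        ring
      · exact (hHp.comp (by fun_prop : Continuous fun t : ℝ => (σ : ℂ) + t * I)).intervalIntegrable
          _ _
    rw [e1, e2]
    have c1 : circleMap 0 R (Real.pi / 2) = R * I := by simp [circleMap, exp_pi_div_two_mul_I]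
    have c2 : circleMap 0 R (-(Real.pi / 2)) = (-R : ℝ) * I := by
      have := exp_neg_pi_div_two_mul_I
      rw [neg_div, neg_mul] at this
      simp [circleMap, this]
    rw [c1, c2]
  have l1 : Continuous fun σ : ℝ => ∫ θ in (-(Real.pi / 2))..(Real.pi / 2),
      circleMap 0 R θ * H (p (σ + circleMap 0 R θ)) := by
    apply intervalIntegral.continuous_parametric_intervalIntegral_of_continuous'
    exact ((continuous_circleMap 0 R).comp continuous_snd).mul (hHp.comp
      ((continuous_ofReal.comp continuous_fst).add ((continuous_circleMap 0 R).comp continuous_snd)))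
  have l2 : Continuous fun σ : ℝ => ∫ t in (-R)..R, H (p (σ + t * I)) := by
    apply intervalIntegral.continuous_parametric_intervalIntegral_of_continuous'
    exact hHp.comp (by fun_prop : Continuous fun q : ℝ × ℝ => (q.1 : ℂ) + q.2 * I)
  have h0 := tendsto_nhds_unique
    ((l1.tendsto 0).mono_left (nhdsWithin_le_nhds (s := Set.Ioi 0)))
    (((l2.tendsto 0).mono_left (nhdsWithin_le_nhds (s := Set.Ioi 0))).congr' (by
      filter_upwards [self_mem_nhdsWithin] with σ hσ using (key σ hσ).symm))
  simp only [ofReal_zero, zero_add] at h0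
  rw [← intervalIntegral.integral_congr (fun θ hθ => ?_), h0]
  · exact intervalIntegral.integral_congr fun t _ => by
      simp only [hpid (t * I) (by simp)]
  · simp only [hpid _ (hcos θ hθ)]

/-- One step of the comparison of `∑ n ^ (-1 - x)` with an integral. -/
theorem mul_rpow_le_rpow_sub_rpow {x : ℝ} (hx : 0 < x) {n : ℝ} (hn : 0 < n) :
    x * (n + 1) ^ (-1 - x) ≤ n ^ (-x) - (n + 1) ^ (-x) := by
  have h1 : (0 : ℝ) < n + 1 := by positivity
  have h2 : n ^ (-x) = (n + 1) ^ (-x) * (n / (n + 1)) ^ (-x) := by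
    rw [← Real.mul_rpow h1.le (by positivity)]; congr 1; field_simp
  have h3 : (n + 1) ^ (-1 - x) = (n + 1) ^ (-x) * (1 / (n + 1)) := by
    rw [sub_eq_neg_add, Real.rpow_add h1, Real.rpow_neg_one, one_div]
  have h4 : 1 + x * (1 / (n + 1)) ≤ (n / (n + 1)) ^ (-x) := by
    rw [Real.rpow_def_of_pos (by positivity)]
    have := Real.log_le_sub_one_of_pos (show 0 < n / (n + 1) by positivity)
    have h5 : n / (n + 1) - 1 = -(1 / (n + 1)) := by field_simp; ring
    have := Real.add_one_le_exp (Real.log (n / (n + 1)) * -x)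
    nlinarith
  rw [h2, h3]
  have h5 : 0 < (n + 1) ^ (-x) := by positivity
  nlinarith

/-- `x ∑_{n ≤ N} n ^ (x - 1) ≤ N ^ x + x N ^ (x - 1)`. -/
theorem mul_sum_rpow_le {x : ℝ} (hx : 0 < x) (N : ℕ) :
    x * ∑ n ∈ Finset.range (N + 1), ((n : ℝ) + 1) ^ (x - 1) ≤
      ((N : ℝ) + 1) ^ x + x * ((N : ℝ) + 1) ^ (x - 1) := by
  have hp : ∀ m : ℕ, (0 : ℝ) < (m : ℝ) + 1 := fun m => by positivity
  -- Bernoulli's inequality compares consecutive powers, in its concave form for `x ≤ 1` and its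
  -- convex form for `x ≥ 1`. Only in the second case is the last summand needed as an extra term.
  rcases le_total x 1 with h1 | h1
  · suffices x * ∑ n ∈ Finset.range (N + 1), ((n : ℝ) + 1) ^ (x - 1) ≤ ((N : ℝ) + 1) ^ x by
      have : 0 ≤ x * ((N : ℝ) + 1) ^ (x - 1) := by positivity
      linarith
    induction N with
    | zero => simpa using h1
    | succ N ih =>
      rw [Finset.sum_range_succ, mul_add]
      have hq : (0 : ℝ) < ((N + 1 : ℕ) : ℝ) + 1 := by positivity
      have h2 := rpow_one_add_le_one_add_mul_self (s := -1 / (((N + 1 : ℕ) : ℝ) + 1))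
        (by rw [le_div_iff₀ hq]; push_cast; linarith [hp N]) hx.le h1
      have h3 : 1 + -1 / (((N + 1 : ℕ) : ℝ) + 1) = ((N : ℝ) + 1) / (((N + 1 : ℕ) : ℝ) + 1) := by
        push_cast; field_simp; ring
      rw [h3, Real.div_rpow (hp N).le hq.le, div_le_iff₀ (by positivity)] at h2
      have h4 : (((N + 1 : ℕ) : ℝ) + 1) ^ (x - 1) =
          (((N + 1 : ℕ) : ℝ) + 1) ^ x / (((N + 1 : ℕ) : ℝ) + 1) := by
        rw [Real.rpow_sub hq, Real.rpow_one]
      rw [h4]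
      have : (1 + x * (-1 / (((N + 1 : ℕ) : ℝ) + 1))) * (((N + 1 : ℕ) : ℝ) + 1) ^ x =
        (((N + 1 : ℕ) : ℝ) + 1) ^ x -
          x * ((((N + 1 : ℕ) : ℝ) + 1) ^ x / (((N + 1 : ℕ) : ℝ) + 1)) := by ring
      linarith
  · induction N with
    | zero => simp
    | succ N ih =>
      rw [Finset.sum_range_succ, mul_add]
      suffices ((N : ℝ) + 1) ^ x + x * ((N : ℝ) + 1) ^ (x - 1) ≤ (((N + 1 : ℕ) : ℝ) + 1) ^ x by
        linarith
      have h2 := one_add_mul_self_le_rpow_one_add (s := 1 / ((N : ℝ) + 1))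
        (by have := hp N; have : 0 < 1 / ((N : ℝ) + 1) := by positivity
            linarith) h1
      have h3 : 1 + 1 / ((N : ℝ) + 1) = (((N + 1 : ℕ) : ℝ) + 1) / ((N : ℝ) + 1) := by
        push_cast; field_simp
      rw [h3, Real.div_rpow (by positivity) (hp N).le, le_div_iff₀ (by positivity)] at h2
      rw [Real.rpow_sub (hp N), Real.rpow_one]
      refine le_trans (le_of_eq ?_) h2
      ring

open Complex in
/-- The remainder of an L-series with coefficients bounded by one. -/
theorem norm_LSeries_sub_sum_le {a : ℕ → ℂ} (ha : ∀ n, ‖a n‖ ≤ 1) {s : ℂ} (hs : 1 < s.re) {N : ℕ}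
    (hN : 0 < N) :
    ‖LSeries a s - ∑ n ∈ Finset.range (N + 1), LSeries.term a s n‖ ≤
      (N : ℝ) ^ (-(s.re - 1)) / (s.re - 1) := by
  set x := s.re - 1 with hx
  have hx0 : 0 < x := by linarith
  have hsum : Summable (LSeries.term a s) :=
    LSeriesSummable_of_bounded_of_one_lt_re (m := 1) (fun n _ => ha n) hs
  have h1 : LSeries a s - ∑ n ∈ Finset.range (N + 1), LSeries.term a s n =
      ∑' n, LSeries.term a s (n + (N + 1)) := by
    rw [LSeries, ← hsum.sum_add_tsum_nat_add (N + 1)]; ring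
  rw [h1]
  have hterm : ∀ n : ℕ, ‖LSeries.term a s (n + (N + 1))‖ ≤
      (((n + N : ℕ) : ℝ) ^ (-x) - ((n + 1 + N : ℕ) : ℝ) ^ (-x)) / x := by
    intro n
    rw [LSeries.norm_term_eq, if_neg (by omega), le_div_iff₀ hx0]
    have h2 := mul_rpow_le_rpow_sub_rpow hx0 (n := ((n + N : ℕ) : ℝ)) (by positivity)
    have h3 : ((n + N : ℕ) : ℝ) + 1 = ((n + 1 + N : ℕ) : ℝ) := by push_cast; ring
    rw [h3] at h2
    refine le_trans ?_ h2
    have h4 : ((n + (N + 1) : ℕ) : ℝ) = ((n + 1 + N : ℕ) : ℝ) := by push_cast; ring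
    rw [h4, show -1 - x = -s.re by rw [hx]; ring, Real.rpow_neg (by positivity), mul_comm]
    have h5 : (0 : ℝ) < ((n + 1 + N : ℕ) : ℝ) ^ s.re := by positivity
    rw [div_eq_mul_inv]
    have h6 := ha (n + (N + 1))
    gcongr
    calc _ ≤ 1 * (((n + 1 + N : ℕ) : ℝ) ^ s.re)⁻¹ := by gcongr
      _ = _ := one_mul _
  have htel : HasSum (fun n : ℕ => (((n + N : ℕ) : ℝ) ^ (-x) - ((n + 1 + N : ℕ) : ℝ) ^ (-x)) / x)
      ((N : ℝ) ^ (-x) / x) := by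
    have hnn : ∀ n : ℕ, 0 ≤ (((n + N : ℕ) : ℝ) ^ (-x) - ((n + 1 + N : ℕ) : ℝ) ^ (-x)) / x :=
      fun n => (norm_nonneg _).trans (hterm n)
    rw [hasSum_iff_tendsto_nat_of_nonneg hnn]
    have h2 : ∀ m : ℕ, ∑ n ∈ Finset.range m,
        (((n + N : ℕ) : ℝ) ^ (-x) - ((n + 1 + N : ℕ) : ℝ) ^ (-x)) / x =
        ((N : ℝ) ^ (-x) - ((m + N : ℕ) : ℝ) ^ (-x)) / x := by
      intro m
      rw [← Finset.sum_div, Finset.sum_range_sub' (fun n : ℕ => ((n + N : ℕ) : ℝ) ^ (-x))]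
      simp
    simp_rw [h2]
    have h3 : Tendsto (fun m : ℕ => ((m + N : ℕ) : ℝ) ^ (-x)) atTop (nhds 0) :=
      (tendsto_rpow_neg_atTop hx0).comp
        (tendsto_natCast_atTop_atTop.comp (tendsto_add_atTop_nat N))
    simpa using (h3.const_sub ((N : ℝ) ^ (-x))).div_const x
  exact tsum_of_norm_bounded htel hterm

open Complex in
/-- The partial sums of an L-series with coefficients bounded by one, to the left of `Re s = 1`. -/
theorem norm_sum_term_le {a : ℕ → ℂ} (ha : ∀ n, ‖a n‖ ≤ 1) {s : ℂ} {x : ℝ} (hx : 0 < x)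
    (hs : s.re = 1 - x) {N : ℕ} (hN : 0 < N) :
    x * ‖∑ n ∈ Finset.range (N + 1), LSeries.term a s n‖ ≤
      (N : ℝ) ^ x + x * (N : ℝ) ^ (x - 1) := by
  obtain ⟨N, rfl⟩ : ∃ M, N = M + 1 := ⟨N - 1, by omega⟩
  have h1 := mul_sum_rpow_le hx N
  push_cast
  refine le_trans ?_ h1
  gcongr
  refine (norm_sum_le _ _).trans ?_
  rw [Finset.sum_range_succ']
  simp only [LSeries.term_zero, norm_zero, add_zero]
  gcongr with n
  rw [LSeries.norm_term_eq, if_neg (by omega), hs, show x - 1 = -(1 - x) by ring,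
    Real.rpow_neg (by positivity), div_eq_mul_inv]
  push_cast
  have : 0 ≤ (((n : ℝ) + 1) ^ (1 - x))⁻¹ := by positivity
  nlinarith [ha (n + 1)]

open Complex in
/-- The norm of Newman's kernel on the circle of radius `R`. -/
theorem norm_newman_kernel {N : ℕ} (hN : 0 < N) {R : ℝ} (hR : 0 < R) {z : ℂ} (hz : ‖z‖ = R) :
    ‖(N : ℂ) ^ z * (1 + z ^ 2 / R ^ 2)‖ = (N : ℝ) ^ z.re * (2 * |z.re| / R) := by
  have hR' : (R : ℂ) ≠ 0 := ofReal_ne_zero.mpr hR.ne'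
  have h1 : 1 + z ^ 2 / (R : ℂ) ^ 2 = z * ((2 * z.re : ℝ) : ℂ) / R ^ 2 := by
    have h2 : z * (starRingEnd ℂ) z = (R : ℂ) ^ 2 := by
      rw [Complex.mul_conj, Complex.normSq_eq_norm_sq, hz]; push_cast; rfl
    rw [← Complex.add_conj, mul_add, h2]
    field_simp
    ring
  rw [norm_mul, norm_natCast_cpow_of_pos hN, h1, norm_div, norm_mul, hz, norm_real, norm_pow,
    norm_real, Real.norm_eq_abs, Real.norm_eq_abs, abs_of_pos hR, abs_mul, abs_two]
  field_simp

open Complex MeasureTheory Topology in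
/-- **Newman's Tauberian theorem**, for an L-series with bounded coefficients whose value at `1`
is zero. -/
theorem tendsto_sum_term_one {a : ℕ → ℂ} (ha : ∀ n, ‖a n‖ ≤ 1) {Q : ℂ → ℂ}
    (hc : ContinuousOn Q {z | 0 ≤ z.re}) (hd : DifferentiableOn ℂ Q {z | 0 < z.re})
    (hQ : ∀ z : ℂ, 0 < z.re → LSeries a (1 + z) = z * Q z) :
    Tendsto (fun N : ℕ => ∑ n ∈ Finset.range (N + 1), LSeries.term a 1 n) atTop (𝓝 0) := by
  set S : ℕ → ℂ → ℂ := fun N z => ∑ n ∈ Finset.range (N + 1), LSeries.term a (1 + z) n with hS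
  have hSd : ∀ N, Differentiable ℂ (S N) := by
    intro N
    refine Differentiable.fun_sum fun n _ => ?_
    rcases eq_or_ne n 0 with rfl | hn
    · simp
    · have hn' : (n : ℂ) ≠ 0 := by exact_mod_cast hn
      simp only [LSeries.term, if_neg hn]
      intro z
      refine DifferentiableAt.div (by fun_prop) ?_ (by simp [cpow_eq_zero_iff, hn'])
      exact DifferentiableAt.const_cpow (by fun_prop) (Or.inl hn')
  set E : ℝ → ℕ → ℂ → ℂ := fun R N z => (N : ℂ) ^ z * (1 + z ^ 2 / R ^ 2) with hE
  have hEd : ∀ R N, 0 < N → Differentiable ℂ (E R N) := by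
    intro R N hN z
    have hn' : (N : ℂ) ≠ 0 := by exact_mod_cast hN.ne'
    refine DifferentiableAt.mul ?_ (by fun_prop)
    exact DifferentiableAt.const_cpow (by fun_prop) (Or.inl hn')
  set J : ℝ → ℕ → ℂ := fun R N => ∫ t in (-R)..R, Q (t * I) * E R N (t * I) with hJ
  have hbound : ∀ R : ℝ, 0 < R → ∀ N : ℕ, 0 < N →
      2 * Real.pi * ‖S N 0‖ ≤ ‖J R N‖ + Real.pi * (2 / R) + Real.pi * (2 / R + 2 / N) := by
    intro R hR N hN
    have hpi := Real.pi_pos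
    have hcirc : ∀ θ, ‖circleMap 0 R θ‖ = R := fun θ => by simp [abs_of_pos hR]
    have hre : ∀ θ, (circleMap 0 R θ).re = R * Real.cos θ := fun θ => by
      simp [circleMap, exp_ofReal_mul_I_re]
    set f : ℂ → ℂ := fun z => S N z * E R N z with hf
    have hfd : Differentiable ℂ f := (hSd N).mul (hEd R N hN)
    have hfc : Continuous fun θ => f (circleMap 0 R θ) :=
      hfd.continuous.comp (continuous_circleMap 0 R)
    -- The mean value property replaces the Cauchy kernel `dz / z`. Starting at `-π/2` splits the
    -- circle into its right and left halves.
    have hmean : ∫ θ in (-(Real.pi / 2))..(-(Real.pi / 2) + 2 * Real.pi), f (circleMap 0 R θ) =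
        2 * Real.pi * S N 0 := by
      have h1 : Real.circleAverage f 0 R = f 0 :=
        DiffContOnCl.circleAverage hfd.diffContOnCl
      have hper : Function.Periodic (fun θ => f (circleMap 0 R θ)) (2 * Real.pi) :=
        fun θ => by simp only [periodic_circleMap 0 R θ]
      have h2 := hper.intervalIntegral_add_eq (-(Real.pi / 2)) 0
      rw [zero_add] at h2
      rw [h2]
      rw [Real.circleAverage_def] at h1
      have h3 : f 0 = S N 0 := by simp [hf, hE]
      rw [h3] at h1
      rw [← h1, real_smul]
      push_cast
      have : (Real.pi : ℂ) ≠ 0 := ofReal_ne_zero.mpr hpi.ne'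
      field_simp
    have hii : ∀ b c, IntervalIntegrable (fun θ => f (circleMap 0 R θ)) volume b c :=
      fun b c => hfc.intervalIntegrable b c
    have hsplit := intervalIntegral.integral_add_adjacent_intervals
      (hii (-(Real.pi / 2)) (Real.pi / 2)) (hii (Real.pi / 2) (-(Real.pi / 2) + 2 * Real.pi))
    have hleft : ‖∫ θ in (Real.pi / 2)..(-(Real.pi / 2) + 2 * Real.pi), f (circleMap 0 R θ)‖ ≤
        Real.pi * (2 / R + 2 / N) := by
      have h1 := intervalIntegral.norm_integral_le_of_norm_le_const
        (a := Real.pi / 2) (b := -(Real.pi / 2) + 2 * Real.pi)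
        (f := fun θ => f (circleMap 0 R θ)) (C := 2 / R + 2 / N) ?_
      · rw [show -(Real.pi / 2) + 2 * Real.pi - Real.pi / 2 = Real.pi by ring, abs_of_pos hpi] at h1
        linarith
      · intro θ hθ
        rw [Set.uIoc_of_le (by linarith)] at hθ
        have hcos : Real.cos θ ≤ 0 :=
          Real.cos_nonpos_of_pi_div_two_le_of_le hθ.1.le (by linarith [hθ.2])
        have hz := hcirc θ
        have hzre := hre θ
        set z := circleMap 0 R θ
        have hx : 0 ≤ -z.re := by rw [hzre]; nlinarith
        have hxR : -z.re ≤ R := by rw [← hz]; exact (neg_le_abs _).trans (abs_re_le_norm z)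
        rw [hf, norm_mul, norm_newman_kernel hN hR hz, abs_of_nonpos (by linarith)]
        rcases hx.eq_or_lt with h0 | h0
        · rw [← h0]
          simp only [mul_zero, zero_div]
          positivity
        · have h2 := norm_sum_term_le ha (s := 1 + z) h0 (by simp) hN
          have hNpos : (0 : ℝ) < N := by exact_mod_cast hN
          have h3 : (N : ℝ) ^ (-z.re) * (N : ℝ) ^ z.re = 1 := by
            rw [← Real.rpow_add hNpos]; simp
          have h4 : (N : ℝ) ^ (-z.re - 1) * (N : ℝ) ^ z.re = 1 / N := by
            rw [← Real.rpow_add hNpos, show -z.re - 1 + z.re = -1 by ring, Real.rpow_neg_one,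
              one_div]
          -- The kernel's factor `|Re z|` cancels the `1 / |Re z|` in the bound for the partial sum,
          -- and its factor `N ^ Re z` cancels the growth in `N`. The same cancellation occurs on
          -- the right arc with the tail of the L-series.
          calc ‖S N z‖ * ((N : ℝ) ^ z.re * (2 * -z.re / R))
              = (-z.re * ‖S N z‖) * ((N : ℝ) ^ z.re * (2 / R)) := by ring
            _ ≤ ((N : ℝ) ^ (-z.re) + -z.re * (N : ℝ) ^ (-z.re - 1)) *
                ((N : ℝ) ^ z.re * (2 / R)) := by gcongr
            _ = ((N : ℝ) ^ (-z.re) * (N : ℝ) ^ z.re) * (2 / R) +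
                -z.re * ((N : ℝ) ^ (-z.re - 1) * (N : ℝ) ^ z.re) * (2 / R) := by ring
            _ = 2 / R + -z.re * (1 / N) * (2 / R) := by rw [h3, h4, one_mul]
            _ ≤ 2 / R + R * (1 / N) * (2 / R) := by gcongr
            _ = 2 / R + 2 / N := by field_simp
    have hright : ‖∫ θ in (-(Real.pi / 2))..(Real.pi / 2), f (circleMap 0 R θ)‖ ≤
        ‖J R N‖ + Real.pi * (2 / R) := by
      set H : ℂ → ℂ := fun z => Q z * E R N z with hH
      have hcosI : ∀ θ ∈ Set.Icc (-(Real.pi / 2)) (Real.pi / 2), 0 ≤ (circleMap 0 R θ).re :=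
        fun θ hθ => by rw [hre]; exact mul_nonneg hR.le (Real.cos_nonneg_of_mem_Icc hθ)
      have hHc : ContinuousOn H {z | 0 ≤ z.re} := hc.mul (hEd R N hN).continuous.continuousOn
      have harc := integral_halfCircle_eq_integral_imaginary_segment hR hHc
        (hd.mul (hEd R N hN).differentiableOn)
      have hint : IntervalIntegrable (fun θ => circleMap 0 R θ * H (circleMap 0 R θ)) volume
          (-(Real.pi / 2)) (Real.pi / 2) := by
        apply ContinuousOn.intervalIntegrable
        rw [Set.uIcc_of_le (by linarith)]
        exact (continuous_circleMap 0 R).continuousOn.mul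
          (hHc.comp (continuous_circleMap 0 R).continuousOn hcosI)
      have hdiff : ‖∫ θ in (-(Real.pi / 2))..(Real.pi / 2),
          (f (circleMap 0 R θ) - circleMap 0 R θ * H (circleMap 0 R θ))‖ ≤ Real.pi * (2 / R) := by
        have h1 := intervalIntegral.norm_integral_le_of_norm_le_const
          (a := -(Real.pi / 2)) (b := Real.pi / 2)
          (f := fun θ => f (circleMap 0 R θ) - circleMap 0 R θ * H (circleMap 0 R θ))
          (C := 2 / R) ?_
        · rw [show Real.pi / 2 - -(Real.pi / 2) = Real.pi by ring, abs_of_pos hpi] at h1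
          linarith
        · intro θ hθ
          rw [Set.uIoc_of_le (by linarith)] at hθ
          have hx := hcosI θ ⟨hθ.1.le, hθ.2⟩
          have hz := hcirc θ
          set z := circleMap 0 R θ
          have h2 : f z - z * H z = -((z * Q z - S N z) * E R N z) := by
            simp only [hf, hH]; ring
          rw [h2, norm_neg, norm_mul, norm_newman_kernel hN hR hz, abs_of_nonneg hx]
          rcases hx.eq_or_lt with h0 | h0
          · rw [← h0]
            simp only [mul_zero, zero_div]
            positivity
          · have h3 := norm_LSeries_sub_sum_le ha (s := 1 + z) (by simpa using h0) hN
            rw [hQ z h0] at h3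
            simp only [add_re, one_re, add_sub_cancel_left] at h3
            have hNpos : (0 : ℝ) < N := by exact_mod_cast hN
            have h4 : (N : ℝ) ^ (-z.re) * (N : ℝ) ^ z.re = 1 := by
              rw [← Real.rpow_add hNpos]; simp
            calc ‖z * Q z - S N z‖ * ((N : ℝ) ^ z.re * (2 * z.re / R))
                ≤ ((N : ℝ) ^ (-z.re) / z.re) * ((N : ℝ) ^ z.re * (2 * z.re / R)) := by gcongr
              _ = ((N : ℝ) ^ (-z.re) * (N : ℝ) ^ z.re) * (2 / R) := by field_simp
              _ = 2 / R := by rw [h4, one_mul]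
      rw [intervalIntegral.integral_sub (hfc.intervalIntegrable _ _) hint, harc] at hdiff
      calc _ ≤ ‖J R N‖ + ‖(∫ θ in (-(Real.pi / 2))..(Real.pi / 2), f (circleMap 0 R θ)) - J R N‖ := by
            rw [add_comm]; exact norm_le_norm_sub_add _ _
        _ ≤ _ := by gcongr
    have hfin : ‖(2 : ℂ) * Real.pi * S N 0‖ ≤
        ‖J R N‖ + Real.pi * (2 / R) + Real.pi * (2 / R + 2 / N) := by
      rw [← hmean, ← hsplit]
      exact (norm_add_le _ _).trans (add_le_add hright hleft)
    simpa [abs_of_pos hpi] using hfin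
  have hJlim : ∀ R : ℝ, 0 < R → Tendsto (J R) atTop (𝓝 0) := by
    intro R hR
    -- On the imaginary axis `N ^ (it) = e ^ (it log N)`, so `J R N` is a Fourier integral at
    -- frequency `-log N / 2π` and the Riemann–Lebesgue lemma applies.
    have h1 := Real.tendsto_integral_exp_smul_cocompact
      ((Set.Ioc (-R) R).indicator fun t : ℝ => Q (t * I) * (1 + (t * I) ^ 2 / R ^ 2))
    have h2 : Tendsto (fun N : ℕ => -(Real.log N / (2 * Real.pi))) atTop (cocompact ℝ) := by
      have h3 : Tendsto (fun N : ℕ => Real.log N / (2 * Real.pi)) atTop atTop :=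
        (Real.tendsto_log_atTop.comp tendsto_natCast_atTop_atTop).atTop_div_const
          (by have := Real.pi_pos; positivity)
      exact (tendsto_neg_atTop_atBot.comp h3).mono_right atBot_le_cocompact
    refine (h1.comp h2).congr' ?_
    filter_upwards [eventually_gt_atTop 0] with N hN
    simp only [hJ, Function.comp]
    rw [intervalIntegral.integral_of_le (by linarith), ← integral_indicator measurableSet_Ioc]
    congr 1
    ext t
    rw [← Set.indicator_const_smul_apply]
    by_cases ht : t ∈ Set.Ioc (-R) R
    · rw [Set.indicator_of_mem ht, Set.indicator_of_mem ht]
      simp only [hE, Circle.smul_def, smul_eq_mul, Real.fourierChar_apply]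
      have hN' : (N : ℂ) ≠ 0 := by exact_mod_cast hN.ne'
      rw [cpow_def_of_ne_zero hN', ← natCast_log]
      have : (Real.pi : ℂ) ≠ 0 := ofReal_ne_zero.mpr Real.pi_ne_zero
      have h3 : ((2 * Real.pi * -(t * -(Real.log N / (2 * Real.pi))) : ℝ) : ℂ) * I =
          (Real.log N : ℂ) * (t * I) := by
        push_cast; field_simp
      rw [h3]
      ring
    · rw [Set.indicator_of_notMem ht, Set.indicator_of_notMem ht]
  rw [Metric.tendsto_atTop]
  intro ε hε
  have hpi := Real.pi_pos
  -- With `R = 8/ε` each of the terms `2/R` is `ε/4`. The total is then at most `π ε`, against the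
  -- required `2π ε`.
  obtain ⟨N₁, hN₁⟩ := Metric.tendsto_atTop.mp (hJlim (8 / ε) (by positivity)) (Real.pi * ε / 4)
    (by positivity)
  obtain ⟨N₂, hN₂⟩ := exists_nat_gt (8 / ε)
  refine ⟨max N₁ N₂ + 1, fun N hN => ?_⟩
  have hNpos : 0 < N := by omega
  have h1 := hbound (8 / ε) (by positivity) N hNpos
  have h2 := hN₁ N (by omega)
  rw [dist_zero_right] at h2 ⊢
  have h3 : S N 0 = ∑ n ∈ Finset.range (N + 1), LSeries.term a 1 n := by simp [hS]
  rw [h3] at h1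
  have h4 : (2 : ℝ) / (8 / ε) = ε / 4 := by field_simp; norm_num
  have h5 : (2 : ℝ) / N ≤ ε / 4 := by
    have h6 : (8 / ε : ℝ) < N := hN₂.trans_le (by exact_mod_cast (by omega : N₂ ≤ N))
    rw [← h4]
    gcongr
  rw [h4] at h1
  have h7 : Real.pi * (ε / 4 + 2 / N) ≤ Real.pi * (ε / 4 + ε / 4) := by gcongr
  have h8 : 2 * Real.pi * ‖∑ n ∈ Finset.range (N + 1), LSeries.term a 1 n‖ <
      2 * Real.pi * ε := by nlinarith
  exact lt_of_mul_lt_mul_left h8 (by positivity)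

open Complex Topology in
/-- The series `∑ μ(n) / n` converges to zero. -/
theorem tendsto_sum_moebius_div :
    Tendsto (fun N : ℕ => ∑ n ∈ Finset.range N, (μ n : ℝ) / n) atTop (𝓝 0) := by
  -- The arithmetic input: `ζ` has no zero on `Re s = 1`. The pole of `ζ` at `1` supplies the factor
  -- `z` in `1/ζ(1 + z) = z / riemannZeta₁ (1 + z)`.
  have hne : ∀ z : ℂ, 0 ≤ z.re → riemannZeta₁ (1 + z) ≠ 0 := by
    intro z hz
    rcases eq_or_ne z 0 with rfl | h0
    · simp
    · have h1 := riemannZeta_ne_zero_of_one_le_re (s := 1 + z) (by simpa using hz)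
      rw [riemannZeta_eq_inv_sub_mul (by simpa using h0)] at h1
      exact right_ne_zero_of_mul h1
  have hdiff : ∀ z : ℂ, 0 ≤ z.re → DifferentiableAt ℂ (fun z => (riemannZeta₁ (1 + z))⁻¹) z :=
    fun z hz => DifferentiableAt.inv (by fun_prop) (hne z hz)
  have h := tendsto_sum_term_one (a := fun n => ((μ n : ℤ) : ℂ))
    (Q := fun z => (riemannZeta₁ (1 + z))⁻¹)
    (fun n => by norm_cast; exact ArithmeticFunction.abs_moebius_le_one)
    (fun z hz => (hdiff z hz).continuousAt.continuousWithinAt)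
    (fun z hz => (hdiff z (le_of_lt hz)).differentiableWithinAt)
    (fun z hz => by
      have hs : 1 < (1 + z).re := by simpa using hz
      have h1 := LSeries_one_mul_Lseries_moebius hs
      rw [LSeries_one_eq_riemannZeta hs] at h1
      have hz0 : z ≠ 0 := by rintro rfl; simp at hz
      rw [riemannZeta_eq_inv_sub_mul (by simpa using hz0), add_sub_cancel_left] at h1
      have h2 := hne z hz.le
      field_simp at h1 ⊢
      linear_combination h1)
  rw [← tendsto_add_atTop_iff_nat 1]
  have h2 := (continuous_re.tendsto 0).comp h
  rw [zero_re] at h2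
  refine h2.congr fun N => ?_
  simp only [Function.comp, re_sum]
  refine Finset.sum_congr rfl fun n _ => ?_
  rw [LSeries.term]
  split_ifs with h0
  · simp [h0]
  · rw [cpow_one, ← ofReal_natCast, ← ofReal_intCast, ← ofReal_div, ofReal_re]

/-! ### Convergence of the series -/

open SummationFilter in
/-- Conditional summation over `ℕ` is convergence of the partial sums. -/
theorem hasSum_conditional_iff_tendsto {f : ℕ → ℝ} {a : ℝ} :
    HasSum f a (conditional ℕ) ↔
      Tendsto (fun N => ∑ n ∈ Finset.range N, f n) atTop (nhds a) := by
  rw [HasSum, conditional_filter_eq_map_range, tendsto_map'_iff]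
  rfl

theorem abs_moebius_cast_le_one (n : ℕ) : |(μ n : ℝ)| ≤ 1 := by
  exact_mod_cast ArithmeticFunction.abs_moebius_le_one (n := n)

theorem abs_moebius_div_rpow_le (k : ℝ) (n : ℕ) : |(μ n : ℝ) / (n : ℝ) ^ k| ≤ 1 / (n : ℝ) ^ k := by
  rw [abs_div, abs_of_nonneg (by positivity : (0 : ℝ) ≤ (n : ℝ) ^ k)]
  gcongr
  exact abs_moebius_cast_le_one n

theorem abs_rieszTerm_le {x : ℝ} (hx : 0 ≤ x) (k : ℝ) (n : ℕ) :
    |rieszTerm k x n| ≤ 1 / (n : ℝ) ^ k := by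
  rw [rieszTerm, abs_mul, Real.abs_exp]
  have h1 : Real.exp (-x / (n : ℝ) ^ 2) ≤ 1 :=
    Real.exp_le_one_iff.mpr (div_nonpos_of_nonpos_of_nonneg (by linarith) (by positivity))
  calc _ ≤ 1 / (n : ℝ) ^ k * 1 := by
        gcongr
        exact abs_moebius_div_rpow_le k n
    _ = _ := mul_one _

theorem summable_rieszTerm {k : ℝ} (hk : 1 < k) {x : ℝ} (hx : 0 ≤ x) :
    Summable (rieszTerm k x) :=
  .of_norm_bounded (Real.summable_one_div_nat_rpow.mpr hk) fun n => abs_rieszTerm_le hx k n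

/-- The partial sums of `∑ μ(n) n^{-k}` converge. -/
theorem exists_tendsto_sum_moebius_div_rpow {k : ℝ} (hk : 1 ≤ k) :
    ∃ A : ℝ, Tendsto (fun N : ℕ => ∑ n ∈ Finset.range N, (μ n : ℝ) / (n : ℝ) ^ k) atTop
      (nhds A) := by
  rcases hk.eq_or_lt with rfl | hk
  · exact ⟨0, by simpa using tendsto_sum_moebius_div⟩
  · have h : Summable fun n : ℕ => (μ n : ℝ) / (n : ℝ) ^ k :=
      .of_norm_bounded (Real.summable_one_div_nat_rpow.mpr hk) fun n => abs_moebius_div_rpow_le k n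
    exact ⟨_, h.hasSum.tendsto_sum_nat⟩

/-- The series defining `P_k(x)` converges conditionally. -/
theorem summable_conditional_rieszTerm {k : ℝ} (hk : 1 ≤ k) {x : ℝ} (hx : 0 ≤ x) :
    Summable (rieszTerm k x) (SummationFilter.conditional ℕ) := by
  obtain ⟨A, hA⟩ := exists_tendsto_sum_moebius_div_rpow hk
  -- Removing the exponential changes the term by `O(x n^{-k-2})`, so the difference converges
  -- absolutely even when `k = 1`.
  have hd : Summable fun n : ℕ => rieszTerm k x n - (μ n : ℝ) / (n : ℝ) ^ k := by
    refine .of_norm_bounded ((Real.summable_one_div_nat_rpow.mpr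
      (show 1 < k + 2 by linarith)).mul_left x) fun n => ?_
    rcases Nat.eq_zero_or_pos n with rfl | hn
    · simp only [rieszTerm, ArithmeticFunction.map_zero, Int.cast_zero, zero_div, zero_mul,
        sub_zero, norm_zero]
      positivity
    · have hn' : (0 : ℝ) < n := by exact_mod_cast hn
      have h1 : |Real.exp (-x / (n : ℝ) ^ 2) - 1| ≤ x / (n : ℝ) ^ 2 := by
        have h2 := Real.add_one_le_exp (-x / (n : ℝ) ^ 2)
        have h3 : Real.exp (-x / (n : ℝ) ^ 2) ≤ 1 :=
          Real.exp_le_one_iff.mpr (div_nonpos_of_nonpos_of_nonneg (by linarith) (by positivity))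
        rw [abs_of_nonpos (by linarith)]
        rw [neg_div] at *
        linarith
      have h2 : rieszTerm k x n - (μ n : ℝ) / (n : ℝ) ^ k =
          (μ n : ℝ) / (n : ℝ) ^ k * (Real.exp (-x / (n : ℝ) ^ 2) - 1) := by
        rw [rieszTerm]; ring
      rw [h2, Real.norm_eq_abs, abs_mul]
      calc _ ≤ 1 / (n : ℝ) ^ k * (x / (n : ℝ) ^ 2) := by
            gcongr
            exact abs_moebius_div_rpow_le k n
        _ = _ := by
            rw [Real.rpow_add hn']
            norm_num
            field_simp
  refine ⟨_, hasSum_conditional_iff_tendsto.mpr ((hA.add hd.hasSum.tendsto_sum_nat).congr ?_)⟩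
  intro N
  rw [← Finset.sum_add_distrib]
  simp

theorem tendsto_sum_rieszTerm {k : ℝ} (hk : 1 ≤ k) {x : ℝ} (hx : 0 ≤ x) :
    Tendsto (fun N => ∑ n ∈ Finset.range N, rieszTerm k x n) atTop (nhds (rieszP k x)) :=
  hasSum_conditional_iff_tendsto.mp (summable_conditional_rieszTerm hk hx).hasSum

/-- Absolute convergence makes the conditional and unconditional sums agree, so termwise estimates
and termwise Mellin transforms become available. -/
theorem hasSum_rieszTerm {k : ℝ} (hk : 1 < k) {x : ℝ} (hx : 0 ≤ x) :
    HasSum (rieszTerm k x) (rieszP k x) := by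
  have h := summable_rieszTerm hk hx
  have h1 := tendsto_nhds_unique h.hasSum.tendsto_sum_nat (tendsto_sum_rieszTerm hk.le hx)
  exact h1 ▸ h.hasSum

/-! ### Size, derivative and decay of `P_k` -/

/-- The elementary bound `P_k(x) = O(x^{-a})`, for `2 a < k - 1`. -/
theorem exists_abs_rieszP_le {k a : ℝ} (ha : 0 ≤ a) (hak : 2 * a < k - 1) :
    ∃ C : ℝ, 0 ≤ C ∧ ∀ x : ℝ, 0 < x → |rieszP k x| ≤ C * x ^ (-a) := by
  have hexp : ∃ B : ℝ, 0 ≤ B ∧ ∀ y : ℝ, 0 < y → Real.exp (-y) ≤ B * y ^ (-a) := by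
    rcases ha.eq_or_lt with rfl | ha
    · exact ⟨1, zero_le_one, fun y hy => by simpa using hy.le⟩
    -- The constant comes from raising `y/a ≤ e^{y/a}` to the power `a`.
    · refine ⟨a ^ a, by positivity, fun y hy => ?_⟩
      have h1 : y / a ≤ Real.exp (y / a) := by linarith [Real.add_one_le_exp (y / a)]
      have h2 : (y / a) ^ a ≤ Real.exp y := by
        calc _ ≤ Real.exp (y / a) ^ a := by gcongr
          _ = _ := by rw [← Real.exp_mul]; congr 1; field_simp
      rw [Real.div_rpow hy.le ha.le, div_le_iff₀ (by positivity)] at h2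
      rw [Real.exp_neg, Real.rpow_neg hy.le, ← div_eq_mul_inv, le_div_iff₀ (by positivity),
        inv_mul_le_iff₀ (Real.exp_pos y)]
      exact h2
  obtain ⟨B, hB, hexp⟩ := hexp
  have hs : Summable fun n : ℕ => 1 / (n : ℝ) ^ (k - 2 * a) :=
    Real.summable_one_div_nat_rpow.mpr (by linarith)
  refine ⟨B * ∑' n : ℕ, 1 / (n : ℝ) ^ (k - 2 * a), ?_, fun x hx => ?_⟩
  · exact mul_nonneg hB (tsum_nonneg fun n => by positivity)
  have h1 := (hasSum_rieszTerm (k := k) (by linarith) hx.le)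
  rw [← Real.norm_eq_abs, ← h1.tsum_eq, mul_assoc, mul_comm (∑' n : ℕ, _), ← mul_assoc]
  refine tsum_of_norm_bounded (hs.hasSum.mul_left (B * x ^ (-a))) fun n => ?_
  rcases Nat.eq_zero_or_pos n with rfl | hn
  · simp only [rieszTerm, ArithmeticFunction.map_zero, Int.cast_zero, zero_div, zero_mul, norm_zero]
    positivity
  · have hn' : (0 : ℝ) < n := by exact_mod_cast hn
    rw [rieszTerm, norm_mul, Real.norm_eq_abs, Real.norm_eq_abs, Real.abs_exp]
    have h2 := hexp (x / (n : ℝ) ^ 2) (by positivity)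
    rw [← neg_div] at h2
    calc _ ≤ 1 / (n : ℝ) ^ k * (B * (x / (n : ℝ) ^ 2) ^ (-a)) := by
          gcongr
          exact abs_moebius_div_rpow_le k n
      _ = _ := by
          rw [Real.div_rpow hx.le (by positivity), Real.rpow_sub hn', ← Real.rpow_natCast,
            ← Real.rpow_mul hn'.le, show ((2 : ℕ) : ℝ) * -a = -(2 * a) by push_cast; ring,
            Real.rpow_neg hn'.le (2 * a)]
          field_simp

/-- `P_k' = -P_{k+2}`. -/
theorem hasDerivAt_rieszP {k : ℝ} (hk : 1 ≤ k) {x : ℝ} (hx : 0 < x) :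
    HasDerivAt (rieszP k) (-rieszP (k + 2) x) x := by
  -- Subtracting the value at `1` makes the series trivially summable at the base point `1`.
  -- Termwise differentiation then applies for `k = 1` too, where the original series need not be
  -- unconditionally summable.
  set g : ℕ → ℝ → ℝ := fun n y => rieszTerm k y n - rieszTerm k 1 n with hg
  have hder : ∀ n : ℕ, ∀ y ∈ Set.Ioi (0 : ℝ), HasDerivAt (g n) (-rieszTerm (k + 2) y n) y := by
    intro n y _
    rcases Nat.eq_zero_or_pos n with rfl | hn
    · simpa [hg, rieszTerm] using hasDerivAt_const y (0 : ℝ)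
    · have hn' : (0 : ℝ) < n := by exact_mod_cast hn
      have h1 : HasDerivAt (fun y : ℝ => -y / (n : ℝ) ^ 2) (-1 / (n : ℝ) ^ 2) y :=
        (hasDerivAt_neg y).div_const _
      have h2 := ((h1.exp).const_mul ((μ n : ℝ) / (n : ℝ) ^ k)).sub_const (rieszTerm k 1 n)
      refine h2.congr_deriv ?_
      rw [rieszTerm, Real.rpow_add hn']
      norm_num
      field_simp
  have hu : Summable fun n : ℕ => 1 / (n : ℝ) ^ (k + 2) :=
    Real.summable_one_div_nat_rpow.mpr (by linarith)
  have hb : ∀ n : ℕ, ∀ y ∈ Set.Ioi (0 : ℝ), ‖-rieszTerm (k + 2) y n‖ ≤ 1 / (n : ℝ) ^ (k + 2) := by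
    intro n y hy
    rw [norm_neg]
    exact abs_rieszTerm_le (le_of_lt hy) _ n
  have hg1 : Summable fun n => g n 1 := by simp [hg]
  have hD := hasDerivAt_tsum_of_isPreconnected hu isOpen_Ioi isPreconnected_Ioi hder hb
    (Set.mem_Ioi.mpr one_pos) hg1 hx
  have hS : ∀ y ∈ Set.Ioi (0 : ℝ), ∑' n, g n y = rieszP k y - rieszP k 1 := by
    intro y hy
    have h1 := (summable_of_summable_hasDerivAt_of_isPreconnected hu isOpen_Ioi isPreconnected_Ioi
      hder hb (Set.mem_Ioi.mpr one_pos) hg1 hy).hasSum.tendsto_sum_nat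
    refine tendsto_nhds_unique h1 ?_
    refine ((tendsto_sum_rieszTerm hk (le_of_lt hy)).sub
      (tendsto_sum_rieszTerm hk zero_le_one)).congr fun N => ?_
    rw [hg, Finset.sum_sub_distrib]
  rw [tsum_neg, (hasSum_rieszTerm (k := k + 2) (by linarith) hx.le).tsum_eq] at hD
  have h2 := (hD.congr_of_eventuallyEq (f₁ := fun y => rieszP k y - rieszP k 1) (by
    filter_upwards [Ioi_mem_nhds hx] with y hy using (hS y hy).symm)).add_const (rieszP k 1)
  simpa using h2

theorem continuousOn_rieszP {k : ℝ} (hk : 1 ≤ k) : ContinuousOn (rieszP k) (Set.Ioi 0) :=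
  fun _ hx => (hasDerivAt_rieszP hk hx).continuousAt.continuousWithinAt

/-- **Abel's inequality** for a nondecreasing weight with values in `[0, 1]`. -/
theorem abs_sum_mul_le_of_monotone {a w : ℕ → ℝ} {ε : ℝ} (hw : Monotone w) (hw0 : ∀ n, 0 ≤ w n)
    (hw1 : ∀ n, w n ≤ 1) (ha : ∀ n, |∑ j ∈ Finset.range n, a j| ≤ ε) (n : ℕ) :
    |∑ j ∈ Finset.range n, a j * w j| ≤ 2 * ε := by
  have hε : 0 ≤ ε := (abs_nonneg _).trans (ha 0)
  have h1 : ∀ n, ∑ j ∈ Finset.range n, a j * w j = (∑ j ∈ Finset.range n, a j) * w n -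
      ∑ j ∈ Finset.range n, (∑ i ∈ Finset.range (j + 1), a i) * (w (j + 1) - w j) := by
    intro n
    induction n with
    | zero => simp
    | succ n ih =>
      rw [Finset.sum_range_succ (fun j => a j * w j), ih,
        Finset.sum_range_succ (fun j => (∑ i ∈ Finset.range (j + 1), a i) * (w (j + 1) - w j)),
        Finset.sum_range_succ a]
      ring
  rw [h1 n]
  have h2 : |(∑ j ∈ Finset.range n, a j) * w n| ≤ ε * 1 := by
    rw [abs_mul, abs_of_nonneg (hw0 n)]
    exact mul_le_mul (ha n) (hw1 n) (hw0 n) hε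
  have h3 : |∑ j ∈ Finset.range n, (∑ i ∈ Finset.range (j + 1), a i) * (w (j + 1) - w j)| ≤
      ε * 1 := by
    refine (Finset.abs_sum_le_sum_abs _ _).trans ?_
    calc _ ≤ ∑ j ∈ Finset.range n, ε * (w (j + 1) - w j) := by
          refine Finset.sum_le_sum fun j _ => ?_
          have : 0 ≤ w (j + 1) - w j := sub_nonneg.mpr (hw (Nat.le_succ j))
          rw [abs_mul, abs_of_nonneg this]
          exact mul_le_mul_of_nonneg_right (ha _) this
      _ = ε * (w n - w 0) := by rw [← Finset.mul_sum, Finset.sum_range_sub]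
      _ ≤ ε * 1 := by
          gcongr
          linarith [hw1 n, hw0 0]
  have := abs_sub ((∑ j ∈ Finset.range n, a j) * w n)
    (∑ j ∈ Finset.range n, (∑ i ∈ Finset.range (j + 1), a i) * (w (j + 1) - w j))
  linarith

/-- `P_k(x) → 0` as `x → ∞`. -/
theorem tendsto_rieszP_atTop {k : ℝ} (hk : 1 ≤ k) : Tendsto (rieszP k) atTop (nhds 0) := by
  obtain ⟨A, hA⟩ := exists_tendsto_sum_moebius_div_rpow hk
  rw [Metric.tendsto_atTop]
  intro ε hε
  -- Two partial sums beyond `M` differ by less than `ε/3`, which Abel's inequality doubles to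
  -- `2ε/3`. Together with `ε/4` for the finite part this stays below `ε`.
  obtain ⟨M, hM⟩ := Metric.cauchySeq_iff'.mp hA.cauchySeq (ε / 6) (by positivity)
  have hfin : Tendsto (fun x => ∑ n ∈ Finset.range (M + 1), rieszTerm k x n) atTop (nhds 0) := by
    rw [← Finset.sum_const_zero (s := Finset.range (M + 1)) (ι := ℕ)]
    refine tendsto_finsetSum _ fun n _ => ?_
    rcases Nat.eq_zero_or_pos n with rfl | hn
    · simp [rieszTerm]
    · have hn' : (0 : ℝ) < (n : ℝ) ^ 2 := by positivity
      have h1 : Tendsto (fun x : ℝ => Real.exp (-x / (n : ℝ) ^ 2)) atTop (nhds 0) :=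
        Real.tendsto_exp_atBot.comp (tendsto_neg_atTop_atBot.atBot_div_const hn')
      simpa [rieszTerm] using h1.const_mul ((μ n : ℝ) / (n : ℝ) ^ k)
  obtain ⟨X, hX⟩ := Metric.tendsto_atTop.mp hfin (ε / 4) (by positivity)
  refine ⟨max X 0, fun x hx => ?_⟩
  have hx0 : 0 ≤ x := (le_max_right _ _).trans hx
  have h1 := hX x ((le_max_left _ _).trans hx)
  -- The weights `e^{-x/n²}` increase with `n` and lie in `[0, 1]`, so Abel's inequality bounds the
  -- tail uniformly in `x`.
  have htail : ∀ m, |∑ j ∈ Finset.range m, rieszTerm k x (M + 1 + j)| ≤ 2 * (ε / 3) := by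
    intro m
    refine abs_sum_mul_le_of_monotone (a := fun j => (μ (M + 1 + j) : ℝ) / ((M + 1 + j : ℕ) : ℝ) ^ k)
      (w := fun j => Real.exp (-x / ((M + 1 + j : ℕ) : ℝ) ^ 2)) ?_ (fun _ => (Real.exp_pos _).le)
      ?_ ?_ m
    · intro i j hij
      simp only [Real.exp_le_exp, neg_div]
      gcongr
    · intro j
      exact Real.exp_le_one_iff.mpr (div_nonpos_of_nonpos_of_nonneg (by linarith) (by positivity))
    · intro n
      have h2 := Finset.sum_range_add (fun j : ℕ => (μ j : ℝ) / (j : ℝ) ^ k) (M + 1) n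
      have h3 := hM (M + 1 + n) (by omega)
      have h4 := hM (M + 1) (by omega)
      rw [Real.dist_eq] at h3 h4
      have h5 : ∑ j ∈ Finset.range n, (μ (M + 1 + j) : ℝ) / ((M + 1 + j : ℕ) : ℝ) ^ k =
        (∑ j ∈ Finset.range (M + 1 + n), (μ j : ℝ) / (j : ℝ) ^ k) -
          ∑ j ∈ Finset.range (M + 1), (μ j : ℝ) / (j : ℝ) ^ k := by
        rw [h2]; ring
      rw [h5]
      rw [abs_lt] at h3 h4
      rw [abs_le]
      constructor <;> linarith
  have h6 : |rieszP k x - ∑ n ∈ Finset.range (M + 1), rieszTerm k x n| ≤ 2 * (ε / 3) := by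
    have h7 := ((tendsto_sum_rieszTerm hk hx0).comp (tendsto_add_atTop_nat (M + 1))).sub_const
      (∑ n ∈ Finset.range (M + 1), rieszTerm k x n)
    refine le_of_tendsto h7.abs (Eventually.of_forall fun m => ?_)
    simp only [Function.comp]
    rw [add_comm m, Finset.sum_range_add, add_sub_cancel_left]
    exact htail m
  rw [dist_zero_right, Real.norm_eq_abs] at h1 ⊢
  have := abs_sub_abs_le_abs_sub (rieszP k x) (∑ n ∈ Finset.range (M + 1), rieszTerm k x n)
  linarith

/-! ### The Mellin transform -/

open Complex in
/-- The Mellin transform of `P_k`. -/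
theorem mellin_rieszP {k : ℝ} {s : ℂ} (hs : 0 < s.re) (hsk : 2 * s.re < k - 1) :
    mellin (fun x => (rieszP k x : ℂ)) s = Gamma s / riemannZeta (k - 2 * s) := by
  have hre : ((k : ℂ) - 2 * s).re = k - 2 * s.re := by simp
  have h := hasSum_mellin (a := fun n : ℕ => (((μ n : ℝ) / (n : ℝ) ^ k : ℝ) : ℂ))
    (p := fun n : ℕ => ((n : ℝ) ^ 2)⁻¹) (F := fun x => (rieszP k x : ℂ)) (s := s)
    (fun n => by
      rcases Nat.eq_zero_or_pos n with rfl | hn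
      · left; simp
      · right; positivity) hs
    (fun x hx => by
      have h1 := (hasSum_rieszTerm (k := k) (by linarith) (le_of_lt hx)).mapL ofRealCLM
      refine h1.congr_fun ?_
      intro n
      simp only [rieszTerm, ofRealCLM_apply, ← ofReal_mul]
      rw [neg_mul, inv_mul_eq_div, neg_div])
    (by
      refine .of_nonneg_of_le (fun n => by positivity) (fun n => ?_)
        (Real.summable_one_div_nat_rpow.mpr (show 1 < k - 2 * s.re by linarith))
      rcases Nat.eq_zero_or_pos n with rfl | hn
      · simp only [ArithmeticFunction.map_zero, Int.cast_zero, zero_div, ofReal_zero, norm_zero]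
        positivity
      · have hn' : (0 : ℝ) < n := by exact_mod_cast hn
        rw [norm_real, Real.norm_eq_abs]
        calc _ ≤ 1 / (n : ℝ) ^ k / (((n : ℝ) ^ 2)⁻¹) ^ s.re := by
              gcongr
              exact abs_moebius_div_rpow_le k n
          _ = _ := by
              rw [Real.inv_rpow (by positivity), ← Real.rpow_natCast, ← Real.rpow_mul hn'.le,
                Real.rpow_sub hn']
              push_cast
              field_simp)
  have hs1 : 1 < ((k : ℂ) - 2 * s).re := by rw [hre]; linarith
  have h2 : HasSum (fun n : ℕ => Gamma s * LSeries.term (fun n => ((μ n : ℤ) : ℂ)) (k - 2 * s) n)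
      (Gamma s * LSeries (fun n => ((μ n : ℤ) : ℂ)) (k - 2 * s)) :=
    ((ArithmeticFunction.LSeriesSummable_moebius_iff.mpr hs1).hasSum).mul_left _
  have h3 := LSeries_one_mul_Lseries_moebius hs1
  rw [LSeries_one_eq_riemannZeta hs1] at h3
  have h4 := riemannZeta_ne_zero_of_one_lt_re hs1
  rw [h.unique (h2.congr_fun ?_)]
  · field_simp
    linear_combination Gamma s * h3
  intro n
  rcases Nat.eq_zero_or_pos n with rfl | hn
  · simp
  · have hn' : (0 : ℝ) < n := by exact_mod_cast hn
    have hnc : (n : ℂ) ≠ 0 := by exact_mod_cast hn.ne'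
    rw [LSeries.term_of_ne_zero hn.ne', mul_div_assoc]
    congr 1
    have h5 : (((((n : ℝ) ^ 2)⁻¹ : ℝ)) : ℂ) ^ s = ((n : ℂ) ^ (2 * s))⁻¹ := by
      rw [ofReal_inv, ofReal_pow, ofReal_natCast, inv_cpow, ← cpow_nat_mul', Nat.cast_ofNat]
      · rw [natCast_arg, mul_zero]; linarith [Real.pi_pos]
      · rw [natCast_arg, mul_zero]; linarith [Real.pi_pos]
      · rw [← Nat.cast_pow, natCast_arg]; exact Real.pi_pos.ne
    rw [h5, cpow_sub _ _ hnc, ofReal_div, ofReal_cpow hn'.le]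
    have : (n : ℂ) ^ (2 * s) ≠ 0 := by simp [cpow_eq_zero_iff, hnc]
    push_cast
    field_simp

open MeasureTheory Complex in
theorem locallyIntegrableOn_rieszP {k : ℝ} (hk : 1 ≤ k) :
    LocallyIntegrableOn (fun x => (rieszP k x : ℂ)) (Set.Ioi 0) :=
  (continuous_ofReal.comp_continuousOn (continuousOn_rieszP hk)).locallyIntegrableOn
    measurableSet_Ioi

open Complex Topology in
theorem mellinConvergent_rieszP {k : ℝ} {s : ℂ} (hs : 0 < s.re) (hsk : 2 * s.re < k - 1) :
    MellinConvergent (fun x => (rieszP k x : ℂ)) s := by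
  -- The exponent is the midpoint of `Re s` and `(k - 1)/2`: large enough for convergence at
  -- infinity, small enough for the elementary bound.
  obtain ⟨C, hC0, hC⟩ := exists_abs_rieszP_le (k := k) (a := (s.re + (k - 1) / 2) / 2)
    (by linarith) (by linarith)
  obtain ⟨B, hB0, hB⟩ := exists_abs_rieszP_le (k := k) (a := 0) le_rfl (by linarith)
  refine mellinConvergent_of_isBigO_rpow (a := (s.re + (k - 1) / 2) / 2) (b := 0)
    (locallyIntegrableOn_rieszP (by linarith)) ?_ (by linarith) ?_ hs
  · refine IsBigO.of_bound C ?_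
    filter_upwards [eventually_gt_atTop 0] with x hx
    rw [norm_real, Real.norm_eq_abs, Real.norm_of_nonneg (by positivity)]
    exact hC x hx
  · refine IsBigO.of_bound B ?_
    filter_upwards [self_mem_nhdsWithin] with x hx
    rw [norm_real, Real.norm_eq_abs, Real.norm_of_nonneg (Real.rpow_nonneg (le_of_lt hx) _)]
    exact hB x hx

/-! ### From the bound to the Riemann hypothesis -/

open Complex in
/-- The Riemann hypothesis follows from the absence of zeros to the right of the critical line. -/
theorem riemannHypothesis_of_ne_zero
    (h : ∀ w : ℂ, 1 / 2 < w.re → w ≠ 1 → riemannZeta w ≠ 0) : RiemannHypothesis := by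
  intro s hs htriv hs1
  rcases lt_trichotomy s.re (1 / 2) with hlt | heq | hgt
  · exfalso
    have hw : 1 / 2 < (1 - s).re := by simp only [sub_re, one_re]; linarith
    have hs0 : s ≠ 0 := by
      rintro rfl
      rw [riemannZeta_zero] at hs
      norm_num at hs
    have hw1 : 1 - s ≠ 1 := by simpa using hs0
    have hfe := riemannZeta_one_sub (s := 1 - s) (fun n hn => by
      rw [hn] at hw
      simp only [neg_re, natCast_re] at hw
      have : (0 : ℝ) ≤ n := n.cast_nonneg
      linarith) hw1
    have hz := h _ hw hw1
    rw [sub_sub_cancel, hs] at hfe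
    have hΓ : Gamma (1 - s) ≠ 0 := Gamma_ne_zero_of_re_pos (by linarith)
    have hpi : ((2 : ℂ) * Real.pi) ^ (-(1 - s)) ≠ 0 := by
      simp [cpow_eq_zero_iff, Real.pi_ne_zero]
    -- In the functional equation only the cosine can vanish. So `s = -2m` for an integer `m`, and
    -- `Re s < 1/2` with `s ≠ 0` makes it a trivial zero.
    have hcos : cos (Real.pi * (1 - s) / 2) = 0 := by
      by_contra hc
      exact mul_ne_zero (mul_ne_zero (mul_ne_zero (mul_ne_zero two_ne_zero hpi) hΓ) hc) hz hfe.symm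
    obtain ⟨m, hm⟩ := cos_eq_zero_iff.mp hcos
    have hpi' : (Real.pi : ℂ) ≠ 0 := ofReal_ne_zero.mpr Real.pi_ne_zero
    have hsm : s = -2 * m := by
      have : (1 - s) = 2 * m + 1 := by
        field_simp at hm
        linear_combination hm
      linear_combination -this
    have hre : s.re = -2 * m := by
      rw [hsm, ← ofReal_intCast, ← ofReal_ofNat, ← ofReal_neg, ← ofReal_mul, ofReal_re]
    have hm1 : 1 ≤ m := by
      have h1 : -(1 : ℝ) < m := by linarith
      have h2 : -1 < m := by exact_mod_cast h1
      have h3 : m ≠ 0 := by rintro rfl; simp at hsm; exact hs0 hsm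
      omega
    refine htriv ⟨(m - 1).toNat, ?_⟩
    have h4 : (((m - 1).toNat : ℕ) : ℂ) = (m : ℂ) - 1 := by
      rw [← Int.cast_natCast, Int.toNat_of_nonneg (by omega)]; push_cast; ring
    rw [hsm, h4]
    ring
  · exact heq
  · exact absurd hs (h s hgt hs1)

open MeasureTheory in
theorem locallyIntegrableOn_indicator {f : ℝ → ℂ} {s t : Set ℝ} (hf : LocallyIntegrableOn f s)
    (ht : MeasurableSet t) : LocallyIntegrableOn (t.indicator f) s := fun x hx =>
  let ⟨u, hu, hi⟩ := hf x hx
  ⟨u, hu, Integrable.indicator hi ht⟩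

open MeasureTheory Complex Topology in
/-- Integration by parts for the Mellin transform of `P_{k+2} = -P_k'` on `(1, ∞)`. -/
theorem integral_Ioi_one_cpow_mul_rieszP {k : ℝ} (hk : 1 ≤ k) {s : ℂ} (hs : -1 < s.re)
    (hs0 : s.re < 0) :
    ∫ x in Set.Ioi (1 : ℝ), (x : ℂ) ^ s * rieszP (k + 2) x =
      rieszP k 1 + s * ∫ x in Set.Ioi (1 : ℝ), (x : ℂ) ^ (s - 1) * rieszP k x := by
  -- `Re s > -1` gives convergence for `P_{k+2}`. `Re s < 0` lets mere boundedness of `P_k` control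
  -- the other integral and kills the boundary term at infinity.
  have hq : IntegrableOn (fun x : ℝ => (x : ℂ) ^ s * rieszP (k + 2) x) (Set.Ioi 1) := by
    have := mellinConvergent_rieszP (k := k + 2) (s := s + 1) (by simp; linarith)
      (by simp; linarith)
    simp only [MellinConvergent, add_sub_cancel_right, smul_eq_mul] at this
    exact this.mono_set (Set.Ioi_subset_Ioi zero_le_one)
  have hbdd : (fun x => (rieszP k x : ℂ)) =O[atTop] fun _ => (1 : ℝ) :=
    (((continuous_ofReal.tendsto 0).comp (tendsto_rieszP_atTop hk))).isBigO_one ℝ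
  have hcont : ContinuousOn (fun x : ℝ => (x : ℂ) ^ (s - 1) * rieszP k x) (Set.Ici 1) := by
    refine ContinuousOn.mul ?_ (continuous_ofReal.comp_continuousOn
      ((continuousOn_rieszP hk).mono (Set.Ici_subset_Ioi.mpr zero_lt_one)))
    exact fun x hx => (continuousAt_ofReal_cpow_const _ _
      (Or.inr (zero_lt_one.trans_le hx).ne')).continuousWithinAt
  have hp : IntegrableOn (fun x : ℝ => (x : ℂ) ^ (s - 1) * rieszP k x) (Set.Ioi 1) := by
    refine (hcont.locallyIntegrableOn measurableSet_Ici).integrableOn_of_isBigO_atTop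
      (g := fun x : ℝ => x ^ (s.re - 1)) ?_
      ⟨Set.Ioi 1, Ioi_mem_atTop 1, integrableOn_Ioi_rpow_of_lt (by linarith) one_pos⟩ |>.mono_set
        Set.Ioi_subset_Ici_self
    have h1 : (fun x : ℝ => (x : ℂ) ^ (s - 1)) =O[atTop] fun x : ℝ => x ^ (s.re - 1) := by
      refine IsBigO.of_bound 1 ?_
      filter_upwards [eventually_gt_atTop 0] with x hx
      rw [norm_cpow_eq_rpow_re_of_pos hx, one_mul, Real.norm_of_nonneg (by positivity)]
      simp
    simpa using h1.mul hbdd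
  have hder : ∀ x ∈ Set.Ici (1 : ℝ), HasDerivAt (fun x : ℝ => (x : ℂ) ^ s * rieszP k x)
      (s * ((x : ℂ) ^ (s - 1) * rieszP k x) - (x : ℂ) ^ s * rieszP (k + 2) x) x := by
    intro x hx
    have hx0 : 0 < x := zero_lt_one.trans_le hx
    have h1 : HasDerivAt (fun x : ℝ => (x : ℂ) ^ s) (s * (x : ℂ) ^ (s - 1)) x := by
      have hs' : s ≠ 0 := by rintro rfl; simp at hs0
      simpa using hasDerivAt_ofReal_cpow_const' (r := s - 1) hx0.ne' (by
        intro h; apply hs'; linear_combination h) |>.const_mul s |>.congr_of_eventuallyEq (by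
          filter_upwards with y
          rw [sub_add_cancel]
          field_simp)
    refine (h1.mul (hasDerivAt_rieszP hk hx0).ofReal_comp).congr_deriv ?_
    push_cast
    ring
  have hlim : Tendsto (fun x : ℝ => (x : ℂ) ^ s * rieszP k x) atTop (𝓝 0) := by
    have h1 : Tendsto (fun x : ℝ => (x : ℂ) ^ s) atTop (𝓝 0) := by
      rw [tendsto_zero_iff_norm_tendsto_zero]
      refine (tendsto_rpow_neg_atTop (y := -s.re) (by linarith)).congr' ?_
      filter_upwards [eventually_gt_atTop 0] with x hx
      rw [norm_cpow_eq_rpow_re_of_pos hx, neg_neg]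
    simpa using h1.mul ((continuous_ofReal.tendsto 0).comp (tendsto_rieszP_atTop hk))
  have h := integral_Ioi_of_hasDerivAt_of_tendsto' hder ((hp.const_mul s).sub hq) hlim
  rw [integral_sub (hp.const_mul s) hq, integral_const_mul] at h
  simp only [ofReal_one, one_cpow, one_mul, zero_sub] at h
  linear_combination -h

open MeasureTheory Complex Topology in
/-- A bound for `P_k` continues `Γ(s + 1) / ζ(k - 2 s)` to a half-plane without poles. -/
theorem riemannHypothesis_of_isBigO_rieszP {k : ℝ} (hk : 1 ≤ k)
    (hO : ∀ ε : ℝ, 0 < ε →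
      (fun x : ℝ => rieszP k x) =O[atTop] (fun x : ℝ => x ^ (-k / 2 + 1 / 4 + ε))) :
    RiemannHypothesis := by
  set f₁ : ℝ → ℂ := (Set.Ioi 1).indicator fun x => (rieszP k x : ℂ) with hf₁
  set f₂ : ℝ → ℂ := (Set.Ioc 0 1).indicator fun x => (rieszP (k + 2) x : ℂ) with hf₂
  -- The right edge corresponds to `Re(k - 2s) = 1/2`; the left edge keeps `s + 1` away from the
  -- poles of `Γ`.
  set U : Set ℂ := {s | -1 < s.re} ∩ {s | s.re < k / 2 - 1 / 4} with hU
  have hUo : IsOpen U :=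
    (isOpen_lt continuous_const continuous_re).inter (isOpen_lt continuous_re continuous_const)
  have hUc : IsPreconnected U :=
    ((convex_halfSpace_re_gt (-1)).inter (convex_halfSpace_re_lt _)).isPreconnected
  have hd₁ : ∀ s ∈ U, DifferentiableAt ℂ (mellin f₁) s := by
    rintro s ⟨-, hs⟩
    simp only [Set.mem_ofPred_eq] at hs
    set ε := (k / 2 - 1 / 4 - s.re) / 2 with hε
    refine mellin_differentiableAt_of_isBigO_rpow (a := k / 2 - 1 / 4 - ε) (b := s.re - 1) ?_ ?_
      (by linarith) ?_ (by linarith)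
    · exact locallyIntegrableOn_indicator (locallyIntegrableOn_rieszP hk) measurableSet_Ioi
    · have h1 := hO ε (by linarith)
      rw [show -k / 2 + 1 / 4 + ε = -(k / 2 - 1 / 4 - ε) by ring] at h1
      have h2 : (fun x => (rieszP k x : ℂ)) =O[atTop] fun x : ℝ => x ^ (-(k / 2 - 1 / 4 - ε)) :=
        IsBigO.of_norm_left (by simpa using h1.norm_left)
      refine h2.congr' ?_ .rfl
      filter_upwards [eventually_gt_atTop 1] with x hx
      rw [hf₁, Set.indicator_of_mem (Set.mem_Ioi.mpr hx)]
    · refine (isBigO_zero _ _).congr' ?_ .rfl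
      filter_upwards [nhdsWithin_le_nhds (Iio_mem_nhds one_pos)] with x hx
      rw [hf₁, Set.indicator_of_notMem (by simpa using le_of_lt hx)]
  have hd₂ : ∀ s ∈ U, DifferentiableAt ℂ (mellin f₂) (s + 1) := by
    rintro s ⟨hs, -⟩
    simp only [Set.mem_ofPred_eq] at hs
    refine mellin_differentiableAt_of_isBigO_rpow (a := s.re + 2) (b := 0) ?_ ?_
      (by simp) ?_ (by simp; linarith)
    · exact locallyIntegrableOn_indicator (locallyIntegrableOn_rieszP (by linarith)) measurableSet_Ioc
    · refine (isBigO_zero _ _).congr' ?_ .rfl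
      filter_upwards [eventually_gt_atTop 1] with x hx
      rw [hf₂, Set.indicator_of_notMem (by simp [hx])]
    · obtain ⟨B, hB0, hB⟩ := exists_abs_rieszP_le (k := k + 2) (a := 0) le_rfl (by linarith)
      refine IsBigO.of_bound B ?_
      filter_upwards [self_mem_nhdsWithin, nhdsWithin_le_nhds (Iio_mem_nhds one_pos)] with x hx hx1
      rw [hf₂, Set.indicator_of_mem (show x ∈ Set.Ioc 0 1 from ⟨hx, le_of_lt hx1⟩), norm_real, Real.norm_eq_abs,
        Real.norm_of_nonneg (Real.rpow_nonneg (le_of_lt hx) _)]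
      exact hB x hx
  set F : ℂ → ℂ := fun s => mellin f₂ (s + 1) + rieszP k 1 + s * mellin f₁ s with hF
  have hFd : DifferentiableOn ℂ F U := by
    intro s hs
    refine (((DifferentiableAt.comp (f := fun s : ℂ => s + 1) s (hd₂ s hs)
      (by fun_prop)).add_const _).add
      (differentiableAt_id.mul (hd₁ s hs))).differentiableWithinAt
  -- Multiplying out by `riemannZeta₁` leaves both sides holomorphic on all of `U`, with no division
  -- by a possible zero of `ζ`.
  have hFeq : ∀ s : ℂ, -1 < s.re → s.re < 0 →
      F s * riemannZeta₁ (k - 2 * s) = (k - 2 * s - 1) * Gamma (s + 1) := by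
    intro s hs hs0
    have h1 := mellin_rieszP (k := k + 2) (s := s + 1) (by simp; linarith) (by simp; linarith)
    have h2 : F s = mellin (fun x => (rieszP (k + 2) x : ℂ)) (s + 1) := by
      have hm₁ : mellin f₁ s = ∫ x in Set.Ioi (1 : ℝ), (x : ℂ) ^ (s - 1) * rieszP k x := by
        rw [mellin, hf₁]
        simp_rw [← Set.indicator_smul_apply (Set.Ioi (1 : ℝ)) (fun t : ℝ => (t : ℂ) ^ (s - 1))]
        rw [setIntegral_indicator measurableSet_Ioi,
          Set.inter_eq_self_of_subset_right (Set.Ioi_subset_Ioi zero_le_one)]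
        simp only [smul_eq_mul]
      have hm₂ : mellin f₂ (s + 1) = ∫ x in Set.Ioc (0 : ℝ) 1, (x : ℂ) ^ s * rieszP (k + 2) x := by
        rw [mellin, hf₂]
        simp_rw [← Set.indicator_smul_apply (Set.Ioc (0 : ℝ) 1)
          (fun t : ℝ => (t : ℂ) ^ (s + 1 - 1))]
        rw [setIntegral_indicator measurableSet_Ioc,
          Set.inter_eq_self_of_subset_right Set.Ioc_subset_Ioi_self]
        simp only [smul_eq_mul, add_sub_cancel_right]
      have hint := mellinConvergent_rieszP (k := k + 2) (s := s + 1) (by simp; linarith)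
        (by simp; linarith)
      simp only [MellinConvergent, add_sub_cancel_right, smul_eq_mul] at hint
      rw [hF]
      simp only
      rw [hm₁, hm₂, add_assoc, ← integral_Ioi_one_cpow_mul_rieszP hk hs hs0, mellin,
        ← setIntegral_union (Set.Ioc_disjoint_Ioi le_rfl) measurableSet_Ioi
          (hint.mono_set Set.Ioc_subset_Ioi_self)
          (hint.mono_set (Set.Ioi_subset_Ioi zero_le_one)),
        Set.Ioc_union_Ioi_eq_Ioi zero_le_one]
      simp only [smul_eq_mul, add_sub_cancel_right]
    have h3 : ((k + 2 : ℝ) : ℂ) - 2 * (s + 1) = k - 2 * s := by push_cast; ring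
    have hw : 1 < ((k : ℂ) - 2 * s).re := by simp; linarith
    have hw1 : (k : ℂ) - 2 * s ≠ 1 := by intro h; rw [h] at hw; simp at hw
    have hz := riemannZeta_ne_zero_of_one_lt_re hw
    have hZ : riemannZeta₁ (k - 2 * s) = (k - 2 * s - 1) * riemannZeta (k - 2 * s) := by
      rw [riemannZeta_eq_inv_sub_mul hw1]
      have := sub_ne_zero.mpr hw1
      field_simp
    rw [h2, h1, h3, hZ, mul_comm ((k : ℂ) - 2 * s - 1), ← mul_assoc, div_mul_cancel₀ _ hz, mul_comm]
  have hid : Set.EqOn (fun s => F s * riemannZeta₁ (k - 2 * s))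
      (fun s => (k - 2 * s - 1) * Gamma (s + 1)) U := by
    have hL : DifferentiableOn ℂ (fun s => F s * riemannZeta₁ (k - 2 * s)) U :=
      hFd.mul (by fun_prop)
    have hR : DifferentiableOn ℂ (fun s => (k - 2 * s - 1) * Gamma (s + 1)) U := by
      intro s hs
      have h1 : DifferentiableAt ℂ Gamma (s + 1) := by
        refine differentiableAt_Gamma _ fun m hm => ?_
        have h2 : (s + 1).re = (-(m : ℂ)).re := by rw [hm]
        simp only [add_re, one_re, neg_re, natCast_re] at h2
        have h3 : (0 : ℝ) ≤ m := m.cast_nonneg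
        have h4 : -1 < s.re := hs.1
        linarith
      exact (DifferentiableAt.mul (by fun_prop) (DifferentiableAt.comp (f := fun s : ℂ => s + 1) s h1
        (by fun_prop))).differentiableWithinAt
    refine (hL.analyticOnNhd hUo).eqOn_of_preconnected_of_eventuallyEq (hR.analyticOnNhd hUo) hUc
      (z₀ := ((-(1 / 2) : ℝ) : ℂ)) ⟨?_, ?_⟩ ?_
    · simp only [Set.mem_ofPred_eq, ofReal_re]; norm_num
    · simp only [Set.mem_ofPred_eq, ofReal_re]; linarith
    · have h1 : {s : ℂ | -1 < s.re} ∩ {s | s.re < 0} ∈ 𝓝 ((-(1 / 2) : ℝ) : ℂ) := by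
        refine ((isOpen_lt continuous_const continuous_re).inter
          (isOpen_lt continuous_re continuous_const)).mem_nhds ⟨?_, ?_⟩ <;>
        · simp only [Set.mem_ofPred_eq, ofReal_re]; norm_num
      filter_upwards [h1] with s hs using hFeq s hs.1 hs.2
  refine riemannHypothesis_of_ne_zero fun w hw hw1 hz => ?_
  -- Zeros with `Re w ≥ 1` are excluded classically. For the rest, `s = (k - w)/2` lies in `U`.
  rcases le_or_gt 1 w.re with h1 | h1
  · exact riemannZeta_ne_zero_of_one_le_re h1 hz
  have hre : (((k : ℂ) - w) / 2).re = (k - w.re) / 2 := by simp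
  have hmem : ((k : ℂ) - w) / 2 ∈ U := by
    constructor <;> simp only [Set.mem_ofPred_eq, hre] <;> linarith
  have h2 := hid hmem
  simp only at h2
  rw [show (k : ℂ) - 2 * ((k - w) / 2) = w by ring] at h2
  have hZ : riemannZeta₁ w = 0 := by
    rw [riemannZeta_eq_inv_sub_mul hw1] at hz
    exact (mul_eq_zero.mp hz).resolve_left (inv_ne_zero (sub_ne_zero.mpr hw1))
  rw [hZ, mul_zero] at h2
  exact mul_ne_zero (sub_ne_zero.mpr hw1) (Gamma_ne_zero_of_re_pos (by
    rw [add_re, hre, one_re]; linarith)) h2.symm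

/-! ### Contour shift and decay of the Gamma function -/

open MeasureTheory Complex Topology in
/-- Shifting a vertical line of integration across a strip on which the integrand is
`O(1 / (1 + t²))`. -/
theorem integrable_and_integral_vertical_eq {f : ℂ → ℂ} {a b C : ℝ} (hab : a ≤ b)
    (hd : DifferentiableOn ℂ f {z | a ≤ z.re ∧ z.re ≤ b})
    (hb : ∀ z : ℂ, a ≤ z.re → z.re ≤ b → ‖f z‖ ≤ C * (1 + z.im ^ 2)⁻¹) :
    Integrable (fun t : ℝ => f (a + t * I)) ∧ Integrable (fun t : ℝ => f (b + t * I)) ∧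
      ∫ t : ℝ, f (a + t * I) = ∫ t : ℝ, f (b + t * I) := by
  have hint : ∀ c : ℝ, a ≤ c → c ≤ b → Integrable fun t : ℝ => f (c + t * I) := by
    intro c hac hcb
    refine Integrable.mono' (integrable_inv_one_add_sq.const_mul C) ?_
      (Eventually.of_forall fun t => by
        simpa using hb (c + t * I) (by simpa using hac) (by simpa using hcb))
    refine (hd.continuousOn.comp_continuous (by fun_prop) fun t => ?_).aestronglyMeasurable
    simpa using ⟨hac, hcb⟩
  refine ⟨hint a le_rfl hab, hint b hab le_rfl, ?_⟩
  have hlim : ∀ c : ℝ, a ≤ c → c ≤ b → Tendsto (fun T : ℝ => ∫ t in (-T)..T, f (c + t * I)) atTop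
      (𝓝 (∫ t : ℝ, f (c + t * I))) := fun c hac hcb =>
    intervalIntegral_tendsto_integral (hint c hac hcb) tendsto_neg_atTop_atBot tendsto_id
  have hhor : ∀ e : ℝ, |e| = 1 →
      Tendsto (fun T : ℝ => ∫ x in a..b, f (x + (e * T : ℝ) * I)) atTop (𝓝 0) := by
    intro e he
    have h1 : Tendsto (fun T : ℝ => C * (1 + T ^ 2)⁻¹ * |b - a|) atTop (𝓝 0) := by
      have h2 : Tendsto (fun T : ℝ => (1 + T ^ 2)⁻¹) atTop (𝓝 0) :=
        tendsto_inv_atTop_zero.comp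
          (tendsto_atTop_add_const_left _ _ (tendsto_pow_atTop two_ne_zero))
      simpa using (h2.const_mul C).mul_const |b - a|
    refine squeeze_zero_norm (fun T => ?_) h1
    refine intervalIntegral.norm_integral_le_of_norm_le_const fun x hx => ?_
    rw [Set.uIoc_of_le hab] at hx
    have h2 := hb (x + (e * T : ℝ) * I) (by simpa using hx.1.le) (by simpa using hx.2)
    have h3 : ((x : ℂ) + (e * T : ℝ) * I).im = e * T := by simp
    rwa [h3, mul_pow, ← sq_abs e, he, one_pow, one_mul] at h2
  have hrect : ∀ T : ℝ, 0 ≤ T → (∫ x in a..b, f (x + (-1 * T : ℝ) * I)) -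
      (∫ x in a..b, f (x + (1 * T : ℝ) * I)) + I * (∫ t in (-T)..T, f (b + t * I)) -
      I * (∫ t in (-T)..T, f (a + t * I)) = 0 := by
    intro T hT
    have h1 := integral_boundary_rect_eq_zero_of_differentiableOn f (a + (-T : ℝ) * I)
      (b + (T : ℝ) * I) (hd.mono fun z hz => by
        have h2 := hz.1
        simp only [add_re, ofReal_re, mul_re, I_re, mul_zero, ofReal_im, I_im, mul_one, sub_self,
          add_zero, Set.mem_preimage] at h2
        rwa [Set.uIcc_of_le hab] at h2)
    simpa using h1
  have h := ((((hhor (-1) (by simp)).sub (hhor 1 (by simp))).add ((hlim b hab le_rfl).const_mul I)).sub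
    ((hlim a le_rfl hab).const_mul I))
  have h0 := tendsto_nhds_unique h ((tendsto_const_nhds (x := (0 : ℂ))).congr' (by
    filter_upwards [eventually_ge_atTop 0] with T hT using (hrect T hT).symm))
  have h4 : I * ((∫ t : ℝ, f (b + t * I)) - ∫ t : ℝ, f (a + t * I)) = 0 := by
    linear_combination h0
  exact (sub_eq_zero.mp ((mul_eq_zero.mp h4).resolve_left I_ne_zero)).symm

open MeasureTheory Complex in
theorem norm_Gamma_le_Gamma_re {s : ℂ} (hs : 0 < s.re) : ‖Gamma s‖ ≤ Real.Gamma s.re := by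
  rw [Gamma_eq_integral hs, GammaIntegral, Real.Gamma_eq_integral hs]
  refine (norm_integral_le_integral_norm _).trans (le_of_eq ?_)
  refine setIntegral_congr_fun measurableSet_Ioi fun x hx => ?_
  simp only [norm_mul, norm_cpow_eq_rpow_re_of_pos hx, sub_re, one_re, norm_real, Real.norm_eq_abs,
    Real.abs_exp]

open Complex in
/-- The Gamma function decays faster than any power of `|t|` on vertical strips. -/
theorem exists_norm_Gamma_mul_pow_le (N : ℕ) {a b : ℝ} (ha : 0 < a) :
    ∃ C : ℝ, ∀ s : ℂ, a ≤ s.re → s.re ≤ b → ‖Gamma s‖ * (1 + |s.im|) ^ N ≤ C := by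
  induction N generalizing a b with
  | zero =>
    have hc : ContinuousOn Real.Gamma (Set.Icc a b) := fun x hx =>
      (Real.differentiableAt_Gamma fun m => by
        have h1 : (0 : ℝ) ≤ m := m.cast_nonneg
        have h2 := hx.1
        linarith).continuousAt.continuousWithinAt
    obtain ⟨C, hC⟩ := isCompact_Icc.exists_bound_of_continuousOn hc
    refine ⟨C, fun s h1 h2 => ?_⟩
    rw [pow_zero, mul_one]
    exact (norm_Gamma_le_Gamma_re (ha.trans_le h1)).trans
      ((Real.le_norm_self _).trans (hC s.re ⟨h1, h2⟩))
  | succ N ih =>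
    obtain ⟨C₁, h₁⟩ := ih (b := b) ha
    -- The strip is shifted by one: `‖s‖ ‖Γ(s)‖ = ‖Γ(s + 1)‖` gains one power of `|Im s|`.
    obtain ⟨C₂, h₂⟩ := ih (a := a + 1) (b := b + 1) (by linarith)
    refine ⟨C₁ + C₂, fun s hsa hsb => ?_⟩
    have hs0 : s ≠ 0 := by rintro rfl; simp at hsa; linarith
    have e1 := h₁ s hsa hsb
    have e2 := h₂ (s + 1) (by simpa using hsa) (by simpa using hsb)
    rw [Gamma_add_one s hs0, norm_mul, add_im, one_im, add_zero] at e2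
    have e3 : |s.im| ≤ ‖s‖ := abs_im_le_norm s
    calc ‖Gamma s‖ * (1 + |s.im|) ^ (N + 1)
        = ‖Gamma s‖ * (1 + |s.im|) ^ N + |s.im| * ‖Gamma s‖ * (1 + |s.im|) ^ N := by ring
      _ ≤ ‖Gamma s‖ * (1 + |s.im|) ^ N + ‖s‖ * ‖Gamma s‖ * (1 + |s.im|) ^ N := by gcongr
      _ ≤ C₁ + C₂ := add_le_add e1 e2

/-! ### Growth of `ζ` and, under the Riemann hypothesis, of `1/ζ` -/

open MeasureTheory Complex Topology in
/-- The continuation of `ζ(s) - 1/(s-1)` to `Re s > 0` by the fractional part integral. -/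
theorem riemannZeta₀_eq_integral {s : ℂ} (hs : 0 < s.re) :
    riemannZeta₀ s =
      1 - s * ∫ t in Set.Ioi (1 : ℝ), (t : ℂ) ^ (-(s + 1)) * ((Int.fract t : ℝ) : ℂ) := by
  set f : ℝ → ℂ := (Set.Ioi 1).indicator fun t => ((Int.fract t : ℝ) : ℂ) with hf
  have hfm : Measurable f :=
    (Complex.measurable_ofReal.comp measurable_fract).indicator measurableSet_Ioi
  have hfb : ∀ t, ‖f t‖ ≤ 1 := by
    intro t
    by_cases ht : t ∈ Set.Ioi (1 : ℝ)
    · rw [hf, Set.indicator_of_mem ht, norm_real, Real.norm_of_nonneg (Int.fract_nonneg t)]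
      exact (Int.fract_lt_one t).le
    · rw [hf, Set.indicator_of_notMem ht, norm_zero]
      exact zero_le_one
  have hloc : LocallyIntegrableOn f (Set.Ioi 0) :=
    ((locallyIntegrable_const (1 : ℝ)).mono hfm.aestronglyMeasurable
      (Eventually.of_forall fun t => by simpa using hfb t)).locallyIntegrableOn _
  have htop : f =O[atTop] fun t : ℝ => t ^ (-(0 : ℝ)) := by
    refine IsBigO.of_bound 1 (Eventually.of_forall fun t => ?_)
    simpa using hfb t
  have hbot : ∀ b : ℝ, f =O[𝓝[>] 0] fun t : ℝ => t ^ (-b) := by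
    intro b
    refine (isBigO_zero _ _).congr' ?_ .rfl
    filter_upwards [nhdsWithin_le_nhds (Iio_mem_nhds one_pos)] with x hx
    rw [hf, Set.indicator_of_notMem (by simpa using le_of_lt hx)]
  have hmel : ∀ s : ℂ, mellin f (-s) =
      ∫ t in Set.Ioi (1 : ℝ), (t : ℂ) ^ (-(s + 1)) * ((Int.fract t : ℝ) : ℂ) := by
    intro s
    rw [mellin, hf]
    simp_rw [← Set.indicator_smul_apply (Set.Ioi (1 : ℝ)) (fun t : ℝ => (t : ℂ) ^ (-s - 1))]
    rw [setIntegral_indicator measurableSet_Ioi,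
      Set.inter_eq_self_of_subset_right (Set.Ioi_subset_Ioi zero_le_one)]
    simp only [smul_eq_mul, neg_add, sub_eq_add_neg]
  set U : Set ℂ := {s | 0 < s.re} with hU
  have hUo : IsOpen U := isOpen_lt continuous_const continuous_re
  have hd : DifferentiableOn ℂ (fun s => 1 - s * mellin f (-s)) U := by
    intro s hs
    have h1 : DifferentiableAt ℂ (mellin f) (-s) :=
      mellin_differentiableAt_of_isBigO_rpow (a := 0) (b := -s.re - 1) hloc htop
        (by simpa [hU] using hs) (hbot _) (by simp)
    exact ((differentiableAt_const _).sub (differentiableAt_id.mul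
      (DifferentiableAt.comp (f := fun s : ℂ => -s) s h1 (by fun_prop)))).differentiableWithinAt
  have heq : ∀ s : ℂ, 1 < s.re → riemannZeta₀ s = 1 - s * mellin f (-s) := by
    intro s hs
    have hs1 : s ≠ 1 := by rintro rfl; simp at hs
    have h1 := LSeries_eq_mul_integral (1 : ℕ → ℂ) zero_le_one hs
      (LSeriesSummable_one_iff.mpr hs) (by
        simp only [Pi.one_apply, Finset.sum_const, Nat.card_Icc, add_tsub_cancel_right,
          nsmul_eq_mul, mul_one, Real.rpow_one]
        exact IsBigO.of_bound 1 (Eventually.of_forall fun n => by simp))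
    rw [LSeries_one_eq_riemannZeta hs] at h1
    -- Abel summation gives `ζ(s) = s ∫ ⌊t⌋ t^{-s-1}` for `Re s > 1`; writing `⌊t⌋ = t - {t}`
    -- isolates the pole.
    have h2 : Set.EqOn (fun t : ℝ => (∑ k ∈ Finset.Icc 1 ⌊t⌋₊, (1 : ℕ → ℂ) k) * (t : ℂ) ^ (-(s + 1)))
        (fun t : ℝ => (t : ℂ) ^ (-s) - (t : ℂ) ^ (-(s + 1)) * ((Int.fract t : ℝ) : ℂ))
        (Set.Ioi 1) := by
      intro t ht
      have ht0 : (0 : ℝ) < t := zero_lt_one.trans ht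
      have htc : (t : ℂ) ≠ 0 := ofReal_ne_zero.mpr ht0.ne'
      have h3 : ((⌊t⌋₊ : ℕ) : ℂ) = t - ((Int.fract t : ℝ) : ℂ) := by
        have h4 : ((⌊t⌋₊ : ℕ) : ℝ) = t - Int.fract t := by
          rw [natCast_floor_eq_intCast_floor ht0.le, Int.self_sub_fract]
        rw [← ofReal_natCast, h4, ofReal_sub]
      have h5 : (t : ℂ) ^ (-s) = t * (t : ℂ) ^ (-(s + 1)) := by
        rw [show -s = 1 + -(s + 1) by ring, cpow_add _ _ htc, cpow_one]
      simp only [Pi.one_apply, Finset.sum_const, Nat.card_Icc, add_tsub_cancel_right,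
        nsmul_eq_mul, mul_one]
      rw [h3, h5]
      ring
    have hi₁ : IntegrableOn (fun t : ℝ => (t : ℂ) ^ (-s)) (Set.Ioi 1) :=
      integrableOn_Ioi_cpow_of_lt (by simpa using hs) one_pos
    have hi₂ : IntegrableOn (fun t : ℝ => (t : ℂ) ^ (-(s + 1)) * ((Int.fract t : ℝ) : ℂ))
        (Set.Ioi 1) := by
      have h6 : MellinConvergent f (-s) :=
        mellinConvergent_of_isBigO_rpow (a := 0) (b := -s.re - 1) hloc htop
          (by simp; linarith) (hbot _) (by simp)
      refine (h6.mono_set (Set.Ioi_subset_Ioi zero_le_one)).congr_fun (fun t ht => ?_)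
        measurableSet_Ioi
      simp only [hf, Set.indicator_of_mem ht, smul_eq_mul, neg_add, sub_eq_add_neg]
    rw [setIntegral_congr_fun measurableSet_Ioi h2, integral_sub hi₁ hi₂, ← hmel,
      integral_Ioi_cpow_of_lt (by simpa using hs) one_pos, ofReal_one, one_cpow,
      riemannZeta_eq_inv_sub_add hs1] at h1
    have h7 : s - 1 ≠ 0 := sub_ne_zero.mpr hs1
    have h8 : -s + 1 ≠ 0 := fun h => h7 (by linear_combination -h)
    have h9 : -1 / (-s + 1) = (s - 1)⁻¹ := by
      field_simp
      ring
    rw [h9] at h1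
    have h10 : s * (s - 1)⁻¹ = 1 + (s - 1)⁻¹ := by field_simp; ring
    linear_combination h1 + h10
  have hid : Set.EqOn riemannZeta₀ (fun s => 1 - s * mellin f (-s)) U := by
    refine (differentiable_riemannZeta₀.differentiableOn.analyticOnNhd
      hUo).eqOn_of_preconnected_of_eventuallyEq (hd.analyticOnNhd hUo)
      (convex_halfSpace_re_gt 0).isPreconnected (z₀ := 2) (by simp [hU]) ?_
    filter_upwards [(isOpen_lt continuous_const continuous_re).mem_nhds
      (show (2 : ℂ) ∈ {s : ℂ | 1 < s.re} by simp)] with s hs using heq s hs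
  rw [← hmel]
  exact hid hs

open MeasureTheory Complex in
/-- Polynomial growth of `(s - 1) ζ(s)` in `Re s ≥ 1/2`. -/
theorem norm_riemannZeta₁_le {s : ℂ} (hs : 1 / 2 ≤ s.re) :
    ‖riemannZeta₁ s‖ ≤ 2 * (1 + ‖s‖) ^ 2 := by
  have h1 : ‖∫ t in Set.Ioi (1 : ℝ), (t : ℂ) ^ (-(s + 1)) * ((Int.fract t : ℝ) : ℂ)‖ ≤ 2 := by
    have h2 : ∫ t in Set.Ioi (1 : ℝ), t ^ (-(3 / 2) : ℝ) = 2 := by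
      rw [integral_Ioi_rpow_of_lt (by norm_num) one_pos]
      norm_num
    rw [← h2]
    refine norm_integral_le_of_norm_le
      (integrableOn_Ioi_rpow_of_lt (by norm_num) one_pos) ?_
    refine (ae_restrict_iff' measurableSet_Ioi).mpr (Eventually.of_forall fun t ht => ?_)
    have ht0 : (0 : ℝ) < t := zero_lt_one.trans ht
    rw [norm_mul, norm_cpow_eq_rpow_re_of_pos ht0, norm_real,
      Real.norm_of_nonneg (Int.fract_nonneg t)]
    calc _ ≤ t ^ (-(3 / 2) : ℝ) * 1 := by
          gcongr
          · exact le_of_lt ht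
          · simp only [neg_re, add_re, one_re]; linarith
          · exact (Int.fract_lt_one t).le
      _ = _ := mul_one _
  have h3 : ‖riemannZeta₀ s‖ ≤ 1 + ‖s‖ * 2 := by
    rw [riemannZeta₀_eq_integral (by linarith)]
    refine (norm_sub_le _ _).trans ?_
    rw [norm_one, norm_mul]
    gcongr
  have h4 : ‖s - 1‖ ≤ ‖s‖ + 1 := by simpa using norm_sub_le s 1
  calc ‖riemannZeta₁ s‖ ≤ 1 + ‖s - 1‖ * ‖riemannZeta₀ s‖ := by
        rw [riemannZeta₁]
        simpa using norm_add_le 1 ((s - 1) * riemannZeta₀ s)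
    _ ≤ 1 + (‖s‖ + 1) * (1 + ‖s‖ * 2) := by gcongr
    _ ≤ 2 * (1 + ‖s‖) ^ 2 := by nlinarith [norm_nonneg s]

open Complex in
/-- A lower bound for `(s - 1) ζ(s)` on the line `Re s = 2`. -/
theorem half_le_norm_riemannZeta₁ {s : ℂ} (hs : s.re = 2) : 1 / 2 ≤ ‖riemannZeta₁ s‖ := by
  have hs1 : 1 < s.re := by linarith
  have hne : s ≠ 1 := by rintro rfl; simp at hs1
  have h1 := LSeries_one_mul_Lseries_moebius hs1
  rw [LSeries_one_eq_riemannZeta hs1] at h1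
  -- The Dirichlet series of `μ` on this line is bounded by `ζ(2) = π²/6 < 2`.
  have h2 : ‖LSeries (fun n => ((μ n : ℤ) : ℂ)) s‖ ≤ 2 := by
    refine (tsum_of_norm_bounded hasSum_zeta_two fun n => ?_).trans ?_
    · rw [LSeries.norm_term_eq]
      split_ifs with h0
      · positivity
      · rw [hs, Real.rpow_two]
        gcongr
        norm_cast
        exact ArithmeticFunction.abs_moebius_le_one
    · nlinarith [Real.pi_lt_d2, Real.pi_pos]
  have h3 : 1 ≤ ‖riemannZeta s‖ * 2 := by
    calc (1 : ℝ) = ‖riemannZeta s‖ * ‖LSeries (fun n => ((μ n : ℤ) : ℂ)) s‖ := by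
          rw [← norm_mul, h1, norm_one]
      _ ≤ _ := by gcongr
  have h4 : riemannZeta₁ s = (s - 1) * riemannZeta s := by
    rw [riemannZeta_eq_inv_sub_mul hne]
    have := sub_ne_zero.mpr hne
    field_simp
  have h5 : 1 ≤ ‖s - 1‖ := by
    have := re_le_norm (s - 1)
    rw [sub_re, one_re, hs] at this
    linarith
  rw [h4, norm_mul]
  nlinarith [norm_nonneg (riemannZeta s)]

open Complex in
/-- A holomorphic logarithm of a zero-free function on a disc, normalized at the centre. -/
theorem exists_log_of_ne_zero_on_ball {f : ℂ → ℂ} {c : ℂ} {R : ℝ} (hR : 0 < R)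
    (hf : DifferentiableOn ℂ f (Metric.ball c R)) (h0 : ∀ z ∈ Metric.ball c R, f z ≠ 0) :
    ∃ g : ℂ → ℂ, DifferentiableOn ℂ g (Metric.ball c R) ∧ g c = 0 ∧
      ∀ z ∈ Metric.ball c R, f z = f c * exp (g z) := by
  have hq : DifferentiableOn ℂ (fun z => deriv f z / f z) (Metric.ball c R) :=
    (hf.deriv Metric.isOpen_ball).div hf h0
  obtain ⟨g, hgc, hg⟩ := hq.isExactOn_ball.with_val_at c 0
  have hgd : DifferentiableOn ℂ g (Metric.ball c R) :=
    fun z hz => (hg z hz).differentiableAt.differentiableWithinAt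
  refine ⟨g, hgd, hgc, fun z hz => ?_⟩
  have hder : ∀ z ∈ Metric.ball c R, HasDerivAt (fun z => f z * exp (-g z)) 0 z := by
    intro z hz
    have h1 := (hf.differentiableAt (Metric.isOpen_ball.mem_nhds hz)).hasDerivAt
    refine (h1.mul (hg z hz).neg.cexp).congr_deriv ?_
    have := h0 z hz
    field_simp
    ring
  have h2 := Metric.isOpen_ball.is_const_of_deriv_eq_zero
    (convex_ball c R).isPreconnected
    (fun z hz => (hder z hz).differentiableAt.differentiableWithinAt)
    (fun z hz => (hder z hz).deriv) hz (Metric.mem_ball_self hR)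
  simp only [hgc, neg_zero, exp_zero, mul_one] at h2
  rw [← h2, mul_assoc, ← exp_add, neg_add_cancel, exp_zero, mul_one]

/-- At `s = 1` the pole is cancelled and the value is nonzero; the trivial zeros all lie to the left
of the half-plane. -/
theorem riemannZeta₁_ne_zero_of_riemannHypothesis (hRH : RiemannHypothesis) {s : ℂ}
    (hs : 1 / 2 < s.re) : riemannZeta₁ s ≠ 0 := by
  rcases eq_or_ne s 1 with rfl | h1
  · simp
  intro h
  have hz : riemannZeta s = 0 := by rw [riemannZeta_eq_inv_sub_mul h1, h, mul_zero]
  refine hs.ne' (hRH s hz ?_ h1)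
  rintro ⟨n, rfl⟩
  have h2 : ((-2 : ℂ) * (n + 1)).re = -2 * (n + 1) := by simp
  rw [h2] at hs
  have : (0 : ℝ) ≤ n := n.cast_nonneg
  linarith

open Complex in
/-- Under the Riemann hypothesis, `1 / ζ` has polynomial growth to the right of the critical
line. -/
theorem exists_norm_inv_riemannZeta₁_le (hRH : RiemannHypothesis) {δ : ℝ} (hδ : 0 < δ) :
    ∃ (C : ℝ) (A : ℕ), 0 ≤ C ∧ ∀ s : ℂ, 1 / 2 + δ ≤ s.re → s.re ≤ 2 →
      ‖(riemannZeta₁ s)⁻¹‖ ≤ C * (1 + |s.im|) ^ A := by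
  -- Borel–Carathéodory with outer radius `3/2` and inner radius at most `3/2 - δ` bounds the
  -- logarithm by `(3/δ) log B`; exponentiating gives the power `3/δ`.
  set A := ⌈3 / δ⌉₊ with hA
  refine ⟨2 * 100 ^ A, 2 * A, by positivity, fun s hs1 hs2 => ?_⟩
  set t := s.im with ht
  -- The centre has the same height as `s`, and the disc of radius `3/2` about it just reaches the
  -- critical line.
  set c : ℂ := 2 + t * I with hc
  have hcre : c.re = 2 := by simp [hc]
  have hball : ∀ z ∈ Metric.ball (0 : ℂ) (3 / 2), 1 / 2 < (c + z).re := by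
    intro z hz
    rw [mem_ball_zero_iff] at hz
    have h2 := (abs_lt.mp ((abs_re_le_norm z).trans_lt hz)).1
    rw [add_re, hcre]
    linarith
  obtain ⟨g, hgd, hg0, hg⟩ := exists_log_of_ne_zero_on_ball (f := fun z => riemannZeta₁ (c + z))
    (c := 0) (R := 3 / 2) (by norm_num) (by fun_prop)
    (fun z hz => riemannZeta₁_ne_zero_of_riemannHypothesis hRH (hball z hz))
  simp only [add_zero] at hg
  have hlow := half_le_norm_riemannZeta₁ hcre
  -- `B` bounds `‖riemannZeta₁ (c + z)‖ / ‖riemannZeta₁ c‖`: the growth bound times the factor `2`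
  -- from the lower bound at the centre.
  set B : ℝ := 4 * (5 + |t|) ^ 2 with hB
  have hB1 : 1 < B := by rw [hB]; nlinarith [abs_nonneg t]
  set M : ℝ := Real.log B with hM
  have hMpos : 0 < M := Real.log_pos hB1
  have hmaps : Set.MapsTo g (Metric.ball 0 (3 / 2)) {z | z.re ≤ M} := by
    intro z hz
    have h1 := norm_riemannZeta₁_le (hball z hz).le
    have h2 : ‖c + z‖ ≤ 4 + |t| := by
      rw [mem_ball_zero_iff] at hz
      have h3 : ‖c‖ ≤ 2 + |t| := by
        refine (norm_add_le _ _).trans ?_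
        simp
      linarith [norm_add_le c z]
    have h3 : ‖riemannZeta₁ (c + z)‖ ≤ 2 * (1 + (4 + |t|)) ^ 2 := by
      refine h1.trans ?_
      gcongr
    rw [hg z hz, norm_mul, norm_exp] at h3
    show (g z).re ≤ Real.log B
    rw [Real.le_log_iff_exp_le (by linarith)]
    have h4 := Real.exp_pos (g z).re
    rw [hB]
    nlinarith
  set z : ℂ := s - c with hz
  have hzs : c + z = s := by rw [hz]; ring
  have hzre : z = ((s.re - 2 : ℝ) : ℂ) := by
    apply Complex.ext <;> simp [hz, hc, ht]
  have hznorm : ‖z‖ = 2 - s.re := by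
    rw [hzre, norm_real, Real.norm_of_nonpos (by linarith)]; ring
  have hzball : z ∈ Metric.ball (0 : ℂ) (3 / 2) := by
    rw [mem_ball_zero_iff, hznorm]; linarith
  have hBC := borelCaratheodory_zero hMpos hgd hmaps (by norm_num) hzball hg0
  have hgz : ‖g z‖ ≤ 3 / δ * M := by
    refine hBC.trans ?_
    rw [hznorm, div_le_iff₀ (by linarith)]
    have h1 : δ ≤ 3 / 2 - (2 - s.re) := by linarith
    calc 2 * M * (2 - s.re) ≤ 2 * M * (3 / 2) := by gcongr; linarith
      _ = 3 / δ * M * δ := by field_simp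
      _ ≤ _ := by gcongr
  have hfin : ‖riemannZeta₁ s‖⁻¹ ≤ 2 * Real.exp (3 / δ * M) := by
    rw [← hzs, hg z hzball, norm_mul, norm_exp, mul_inv, ← Real.exp_neg]
    gcongr
    · rw [inv_le_comm₀ (by linarith) two_pos]
      linarith
    · exact (neg_le_abs _).trans ((abs_re_le_norm _).trans hgz)
  rw [norm_inv]
  calc ‖riemannZeta₁ s‖⁻¹ ≤ 2 * Real.exp (3 / δ * M) := hfin
    _ ≤ 2 * Real.exp (A * M) := by
        gcongr
        exact Nat.le_ceil _
    _ = 2 * B ^ A := by rw [hM, Real.exp_nat_mul, Real.exp_log (by linarith)]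
    _ ≤ 2 * (100 * (1 + |t|) ^ 2) ^ A := by
        gcongr
        rw [hB]
        nlinarith [abs_nonneg t]
    _ = _ := by rw [mul_pow, ← pow_mul, mul_assoc]

/-! ### From the Riemann hypothesis to the bound -/

open MeasureTheory Complex Topology in
/-- Under the Riemann hypothesis, shifting the line of integration in the Mellin inversion formula
bounds `P_{k+2}`. -/
theorem exists_abs_rieszP_add_two_le (hRH : RiemannHypothesis) {k δ : ℝ} (hk : 1 ≤ k) (hδ : 0 < δ)
    (hδ1 : δ ≤ 1) :
    ∃ C : ℝ, ∀ x : ℝ, 1 ≤ x → |rieszP (k + 2) x| ≤ C * x ^ (-(k / 2 + 3 / 4 - δ / 2)) := by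
  -- On `Re s = a` the argument `k + 2 - 2s` has real part `2`, where the Mellin formula is
  -- available; on `Re s = b` it has real part `1/2 + δ`.
  set a : ℝ := k / 2 with ha
  set b : ℝ := k / 2 + 3 / 4 - δ / 2 with hb
  have hab : a ≤ b := by rw [ha, hb]; linarith
  have ha0 : 0 < a := by rw [ha]; linarith
  set G : ℂ → ℂ := fun s => Gamma s * ((k + 1 - 2 * s) * (riemannZeta₁ (k + 2 - 2 * s))⁻¹) with hG
  have hre : ∀ s : ℂ, ((k : ℂ) + 2 - 2 * s).re = k + 2 - 2 * s.re := fun s => by simp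
  have him : ∀ s : ℂ, ((k : ℂ) + 2 - 2 * s).im = -(2 * s.im) := fun s => by simp
  obtain ⟨C₁, A, hC₁, h₁⟩ := exists_norm_inv_riemannZeta₁_le hRH hδ
  -- The exponent pays `A` for `1/riemannZeta₁`, one for the factor `k + 1 - 2s`, and two for
  -- integrability.
  obtain ⟨C₂, h₂⟩ := exists_norm_Gamma_mul_pow_le (A + 3) (b := b) ha0
  have hGd : ∀ s : ℂ, a ≤ s.re → s.re ≤ b → DifferentiableAt ℂ G s := by
    intro s hsa hsb
    have hΓ : DifferentiableAt ℂ Gamma s := by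
      refine differentiableAt_Gamma _ fun m hm => ?_
      have h2 : s.re = (-(m : ℂ)).re := by rw [hm]
      simp only [neg_re, natCast_re] at h2
      have h3 : (0 : ℝ) ≤ m := m.cast_nonneg
      linarith
    refine hΓ.mul (DifferentiableAt.mul (by fun_prop) (DifferentiableAt.inv (by fun_prop) ?_))
    refine riemannZeta₁_ne_zero_of_riemannHypothesis hRH ?_
    rw [hre]
    linarith
  have hGb : ∀ s : ℂ, a ≤ s.re → s.re ≤ b →
      ‖G s‖ ≤ C₁ * 2 ^ (A + 1) * C₂ * (1 + s.im ^ 2)⁻¹ := by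
    intro s hsa hsb
    have e1 := h₁ (k + 2 - 2 * s) (by rw [hre]; linarith) (by rw [hre]; linarith)
    rw [him, abs_neg, abs_mul, abs_two] at e1
    have e2 := h₂ s hsa hsb
    have e3 : ‖(k : ℂ) + 1 - 2 * s‖ ≤ 1 + 2 * |s.im| := by
      refine (norm_le_abs_re_add_abs_im _).trans ?_
      have h4 : ((k : ℂ) + 1 - 2 * s).re = k + 1 - 2 * s.re := by simp
      have h5 : ((k : ℂ) + 1 - 2 * s).im = -(2 * s.im) := by simp
      rw [h4, h5, abs_neg, abs_mul, abs_two]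
      gcongr
      rw [abs_le]
      constructor <;> linarith
    have e4 : 1 + s.im ^ 2 ≤ (1 + |s.im|) ^ 2 := by
      nlinarith [sq_abs s.im, abs_nonneg s.im]
    have e5 : 1 + 2 * |s.im| ≤ 2 * (1 + |s.im|) := by linarith
    rw [← div_eq_mul_inv, le_div_iff₀ (by positivity)]
    calc ‖G s‖ * (1 + s.im ^ 2)
        = ‖Gamma s‖ * (‖(k : ℂ) + 1 - 2 * s‖ * ‖(riemannZeta₁ (k + 2 - 2 * s))⁻¹‖) *
            (1 + s.im ^ 2) := by rw [hG, norm_mul, norm_mul]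
      _ ≤ ‖Gamma s‖ * ((1 + 2 * |s.im|) * (C₁ * (1 + 2 * |s.im|) ^ A)) * (1 + |s.im|) ^ 2 := by
          gcongr
      _ ≤ ‖Gamma s‖ * ((2 * (1 + |s.im|)) * (C₁ * (2 * (1 + |s.im|)) ^ A)) * (1 + |s.im|) ^ 2 := by
          gcongr
      _ = C₁ * 2 ^ (A + 1) * (‖Gamma s‖ * (1 + |s.im|) ^ (A + 3)) := by
          rw [mul_pow]; ring
      _ ≤ C₁ * 2 ^ (A + 1) * C₂ := by gcongr
  obtain ⟨hGa, hGbi, -⟩ := integrable_and_integral_vertical_eq hab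
    (fun s hs => (hGd s hs.1 hs.2).differentiableWithinAt) hGb
  refine ⟨1 / (2 * Real.pi) * ∫ t : ℝ, ‖G (b + t * I)‖, fun x hx => ?_⟩
  have hx0 : 0 < x := zero_lt_one.trans_le hx
  have hxc : (x : ℂ) ≠ 0 := ofReal_ne_zero.mpr hx0.ne'
  have hmel : ∀ t : ℝ, mellin (fun x => (rieszP (k + 2) x : ℂ)) (a + t * I) = G (a + t * I) := by
    intro t
    have hre' : ((a : ℂ) + t * I).re = a := by simp
    rw [mellin_rieszP (by rw [hre']; exact ha0) (by rw [hre', ha]; linarith), hG]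
    have hw : ((k + 2 : ℝ) : ℂ) - 2 * (a + t * I) = k + 2 - 2 * (a + t * I) := by push_cast; ring
    have hw1 : (k : ℂ) + 2 - 2 * (a + t * I) ≠ 1 := by
      intro h
      have := congrArg re h
      rw [hre, hre', ha, one_re] at this
      linarith
    rw [hw, riemannZeta_eq_inv_sub_mul hw1, div_eq_mul_inv, mul_inv, inv_inv]
    ring
  have hinv := mellinInv_mellin_eq a (fun x => (rieszP (k + 2) x : ℂ)) hx0
    (mellinConvergent_rieszP (by simpa using ha0) (by rw [ofReal_re, ha]; linarith))
    (by simpa only [VerticalIntegrable, hmel] using hGa)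
    (continuous_ofReal.continuousAt.comp
      (hasDerivAt_rieszP (k := k + 2) (by linarith) hx0).continuousAt)
  rw [mellinInv] at hinv
  simp only [hmel] at hinv
  obtain ⟨-, -, hshift⟩ := integrable_and_integral_vertical_eq (a := a) (b := b)
    (f := fun s => (x : ℂ) ^ (-s) * G s) (C := x ^ (-a) * (C₁ * 2 ^ (A + 1) * C₂)) hab
    (fun s hs => (DifferentiableAt.mul (DifferentiableAt.const_cpow (by fun_prop) (Or.inl hxc))
      (hGd s hs.1 hs.2)).differentiableWithinAt)
    (fun s hsa hsb => by
      rw [norm_mul, norm_cpow_eq_rpow_re_of_pos hx0, neg_re, mul_assoc (x ^ (-a))]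
      exact mul_le_mul (Real.rpow_le_rpow_of_exponent_le hx (neg_le_neg hsa)) (hGb s hsa hsb)
        (norm_nonneg _) (by positivity))
  have hnorm : ∀ t : ℝ, ‖(x : ℂ) ^ (-((b : ℂ) + t * I)) * G (b + t * I)‖ =
      x ^ (-b) * ‖G (b + t * I)‖ := fun t => by
    rw [norm_mul, norm_cpow_eq_rpow_re_of_pos hx0]
    simp
  simp only [smul_eq_mul] at hinv
  rw [hshift] at hinv
  have h3 : |rieszP (k + 2) x| = ‖(rieszP (k + 2) x : ℂ)‖ := by rw [norm_real, Real.norm_eq_abs]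
  rw [h3, ← hinv, norm_smul]
  have h4 : ‖∫ t : ℝ, (x : ℂ) ^ (-((b : ℂ) + t * I)) * G (b + t * I)‖ ≤
      x ^ (-b) * ∫ t : ℝ, ‖G (b + t * I)‖ := by
    rw [← integral_const_mul]
    refine (norm_integral_le_integral_norm _).trans (le_of_eq ?_)
    exact integral_congr_ae (Eventually.of_forall hnorm)
  have h5 : ‖(1 / (2 * Real.pi) : ℝ)‖ = 1 / (2 * Real.pi) :=
    Real.norm_of_nonneg (by have := Real.pi_pos; positivity)
  rw [h5, mul_assoc, mul_comm (∫ t : ℝ, _)]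
  have := Real.pi_pos
  gcongr

open MeasureTheory in
/-- A power bound for `P_{k+2} = -P_k'` integrates to one for `P_k`. -/
theorem abs_rieszP_le_of_abs_rieszP_add_two_le {k b C : ℝ} (hk : 1 ≤ k) (hb : 1 < b)
    (h : ∀ x : ℝ, 1 ≤ x → |rieszP (k + 2) x| ≤ C * x ^ (-b)) {x : ℝ} (hx : 1 ≤ x) :
    |rieszP k x| ≤ C / (b - 1) * x ^ (1 - b) := by
  have hx0 : 0 < x := zero_lt_one.trans_le hx
  have hmaj : IntegrableOn (fun t : ℝ => C * t ^ (-b)) (Set.Ioi x) :=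
    (integrableOn_Ioi_rpow_of_lt (by linarith) hx0).const_mul C
  have hae : ∀ᵐ t ∂volume.restrict (Set.Ioi x), ‖-rieszP (k + 2) t‖ ≤ C * t ^ (-b) := by
    refine (ae_restrict_iff' measurableSet_Ioi).mpr (Eventually.of_forall fun t ht => ?_)
    rw [norm_neg]
    exact h t (hx.trans (le_of_lt ht))
  have hcont : ContinuousOn (fun t => -rieszP (k + 2) t) (Set.Ioi x) :=
    ((continuousOn_rieszP (by linarith)).mono (Set.Ioi_subset_Ioi hx0.le)).neg
  have hint : IntegrableOn (fun t => -rieszP (k + 2) t) (Set.Ioi x) :=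
    Integrable.mono' hmaj (hcont.aestronglyMeasurable measurableSet_Ioi) hae
  -- Decay at infinity fixes the constant of integration: `P_k(x) = ∫_x^∞ P_{k+2}`.
  have h1 := integral_Ioi_of_hasDerivAt_of_tendsto'
    (fun t (ht : x ≤ t) => hasDerivAt_rieszP hk (hx0.trans_le ht)) hint (tendsto_rieszP_atTop hk)
  have h2 := norm_integral_le_of_norm_le hmaj hae
  rw [h1, zero_sub, norm_neg, Real.norm_eq_abs, integral_const_mul,
    integral_Ioi_rpow_of_lt (by linarith) hx0] at h2
  refine h2.trans (le_of_eq ?_)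
  have h3 : b - 1 ≠ 0 := by linarith
  have h4 : -b + 1 ≠ 0 := by intro h; apply h3; linarith
  rw [show 1 - b = -b + 1 by ring]
  field_simp
  ring

theorem isBigO_rieszP_of_riemannHypothesis (hRH : RiemannHypothesis) {k ε : ℝ} (hk : 1 ≤ k)
    (hε : 0 < ε) :
    (fun x : ℝ => rieszP k x) =O[atTop] (fun x : ℝ => x ^ (-k / 2 + 1 / 4 + ε)) := by
  -- The cap `1/4` keeps `k/2 + 3/4 - δ/2 > 1` even at `k = 1`, so that the bound for `P_{k+2}` is
  -- integrable.
  set δ := min ε (1 / 4) with hδ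
  have hδ0 : 0 < δ := lt_min hε (by norm_num)
  have hδ1 : δ ≤ 1 / 4 := min_le_right _ _
  have hδε : δ ≤ ε := min_le_left _ _
  obtain ⟨C, hC⟩ := exists_abs_rieszP_add_two_le hRH hk hδ0 (by linarith)
  have hC0 : 0 ≤ C := by simpa using (abs_nonneg _).trans (hC 1 le_rfl)
  refine IsBigO.of_bound (C / (k / 2 + 3 / 4 - δ / 2 - 1)) ?_
  filter_upwards [eventually_ge_atTop 1] with x hx
  rw [Real.norm_of_nonneg (by positivity : 0 ≤ x ^ (-k / 2 + 1 / 4 + ε)), Real.norm_eq_abs]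
  refine (abs_rieszP_le_of_abs_rieszP_add_two_le hk (by linarith) hC hx).trans ?_
  gcongr
  · exact div_nonneg hC0 (by linarith)
  · linarith

theorem theorem2 (k : ℝ) (hk : 1 ≤ k) :
    (∀ x : ℝ, 0 < x → Summable (rieszTerm k x) (SummationFilter.conditional ℕ)) ∧
    (RiemannHypothesis ↔
      ∀ ε : ℝ, 0 < ε →
        (fun x : ℝ => rieszP k x) =O[atTop] (fun x : ℝ => x ^ (-k / 2 + 1 / 4 + ε))) :=
  ⟨fun _ hx => summable_conditional_rieszTerm hk hx.le,
    fun hRH _ hε => isBigO_rieszP_of_riemannHypothesis hRH hk hε,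
    riemannHypothesis_of_isBigO_rieszP hk⟩
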